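/- **Setting.** Let $\beta,J>0$. For $h\in\mathbb R^{\mathbb N}$ ($\mathbb N=\{1,2,\dots\}$) and $n\ge 1$ let $$H_n^{J,h}[\phi]=-\frac{J}{2n}\sum_{i,j=1}^n\phi_i\phi_j-\sum_{i=1}^n h_i\phi_i ,\qquad \phi\in\mathbb R^n,$$ let $\omega_n$ be the uniform probability measure on the sphere of radius $\sqrt n$ centred at $0$ in $\mathbb R^n$, and let $\mu_n^{\beta,J,h}$ be the probability measure $Z_n^{-1}e^{-\beta H_n^{J,h}}\,d\omega_n$, $Z_n=\int e^{-\beta H_n^{J,h}}d\omega_n$, regarded as a probability measure on $\mathbb R^{\mathbb N}$ by setting all coordinates of index $>n$ equal to $0$. For any topological space $S$ with its Borel $\sigma$-algebra, $\mathcal M_1(S)$ denotes the set of Borel probability measures on $S$ with the topology of weak convergence; $\mathbb R^{\mathbb N}$ has the product topology. The Newman–Stein metastates are $$\overline\kappa_N^{\beta,J,h}=\frac1N\sum_{n=1}^N\delta_{\mu_n^{\beta,J,h}}\in\mathcal M_1(\mathcal M_1(\mathbb R^{\mathbb N})).$$ (A1) $h=(h_i)_{i\ge1}$ is a random element of $\mathbb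 R^{\mathbb N}$ whose components are independent with the law of a real random variable $h_0$ such that $\mathbb E h_0^2<\infty$ and $\mathbb V h_0>0$. Put $m=(m^\parallel,m^\perp)=(\mathbb E h_0,\sqrt{\mathbb V h_0})$ and, for $z=(x,y)$ in the open unit disk $B(0,1)\subset\mathbb R^2$, $$\psi^{\beta,J,m}(z)=\frac{\beta J}{2}x^2+\beta\langle m,z\rangle+\frac12\ln(1-\|z\|^2).$$ Let $M^*(\beta,J,m)$ be the set of global maximizing points of $\psi^{\beta,J,m}$ on $B(0,1)$. The pure-state parameter range is the set of parameters for which $M^*(\beta,J,m)$ consists of a single point $z^*$. For $z=(x,y)\in B(0,1)$ let $\nu_\infty^{z,h}$ be the law on $\mathbb R^{\mathbb N}$ (for fixed $h$) of $$\Big(\sqrt{1-\|z\|^2}\,\phi_i+x+y\,\frac{h_i-m^\parallel}{m^\perp}\Big)_{i\ge1},$$ where $\phi_1,\phi_2,\dots$ are independent standard Gaussian random variables. **Theorem.** Assume (A1) and let the parameters be in the pure-state range, $M^*(\beta,J,m)=\{z^*\}$. Then $$\lim_{n\to\infty}(h,\mu_n^{\beta,J,h})=(h,\nu_\infty^{z^*,h})\quad\text{in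 distribution}$$ as $\mathbb R^{\mathbb N}\times\mathcal M_1(\mathbb R^{\mathbb N})$-valued random variables, and $$\lim_{N\to\infty}\overline\kappa_N^{\beta,J,h}=\delta_{\nu_\infty^{z^*,h}}\quad\text{almost surely}$$ in $\mathcal M_1(\mathcal M_1(\mathbb R^{\mathbb N}))$. -/

import Mathlib

open MeasureTheory ProbabilityTheory Filter Topology

/-! ### The space of probability measures is a Borel space

The `σ`-algebra that Mathlib puts on `ProbabilityMeasure X` (generated by the evaluations
`μ ↦ μ s`) is the Borel `σ`-algebra of the topology of weak convergence. -/

/-- Sets `{μ | r < μ U}` with `U` open are open for the weak topology. -/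
theorem isOpen_setOf_lt_probabilityMeasure {X : Type*} [TopologicalSpace X]
    [TopologicalSpace.PseudoMetrizableSpace X] [MeasurableSpace X] [BorelSpace X]
    {U : Set X} (hU : IsOpen U) (r : ENNReal) :
    IsOpen {μ : ProbabilityMeasure X | r < (μ : Measure X) U} := by
  rw [isOpen_iff_mem_nhds]
  intro μ hμ
  have h := ProbabilityMeasure.le_liminf_measure_open_of_tendsto
    (L := 𝓝 μ) (μs := fun ν : ProbabilityMeasure X => ν) tendsto_id hU
  exact eventually_lt_of_lt_liminf (lt_of_lt_of_le hμ h)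

instance instBorelSpaceProbabilityMeasure {X : Type*} [TopologicalSpace X]
    [TopologicalSpace.PseudoMetrizableSpace X] [SecondCountableTopology X]
    [MeasurableSpace X] [BorelSpace X] : BorelSpace (ProbabilityMeasure X) := by
  constructor
  apply le_antisymm
  · -- every evaluation is Borel measurable
    have key : @Measurable _ _ (borel (ProbabilityMeasure X)) _
        (fun μ : ProbabilityMeasure X => (μ : Measure X)) := by
      let : MeasurableSpace (ProbabilityMeasure X) := borel _
      have : BorelSpace (ProbabilityMeasure X) := ⟨rfl⟩
      refine Measurable.measure_of_isPiSystem_of_isProbabilityMeasure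
        (S := {s : Set X | IsOpen s}) (BorelSpace.measurable_eq) isPiSystem_isOpen ?_
      intro s hs
      exact measurable_of_Ioi fun r => (isOpen_setOf_lt_probabilityMeasure hs r).measurableSet
    exact key.comap_le
  · -- every open set is measurable for the `σ`-algebra generated by evaluations
    obtain ⟨B, hBc, -, hB⟩ := TopologicalSpace.exists_countable_basis X
    let gen : Set (Set (ProbabilityMeasure X)) :=
      (fun p : Set (Set X) × ℚ => {μ : ProbabilityMeasure X |
        ((Real.toNNReal p.2 : NNReal) : ENNReal) < (μ : Measure X) (⋃₀ p.1)}) ''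
        ({T : Set (Set X) | T.Finite ∧ T ⊆ B} ×ˢ Set.univ)
    have hgc : gen.Countable :=
      ((Set.countable_ofPred_finite_subset hBc).prod (Set.countable_univ)).image _
    have hmeas : ∀ s ∈ gen, MeasurableSet s := by
      rintro _ ⟨⟨T, r⟩, ⟨⟨-, hTB⟩, -⟩, rfl⟩
      have hT : MeasurableSet (⋃₀ T) :=
        (isOpen_sUnion fun t ht => hB.isOpen (hTB ht)).measurableSet
      exact measurableSet_lt measurable_const
        ((Measure.measurable_coe hT).comp measurable_subtype_coe)
    have hlim : ∀ (L : Filter (ProbabilityMeasure X)) (μ : ProbabilityMeasure X),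
        L.IsCountablyGenerated → (∀ s ∈ gen, μ ∈ s → s ∈ L) → L ≤ 𝓝 μ := by
      intro L μ hL hs
      refine tendsto_of_forall_isOpen_le_liminf' (L := L)
        (μs := fun ν : ProbabilityMeasure X => ν) fun G hG => ?_
      refine le_of_forall_lt fun r hr => ?_
      obtain ⟨q, -, hrq, hqG⟩ := ENNReal.lt_iff_exists_rat_btwn.1 hr
      obtain ⟨T, hTB, hTμ, hTG⟩ := μ.exists_lt_measure_biUnion_of_isOpen (S := B)
        (fun u hu x hx => by
          obtain ⟨v, hvB, hxv, hvu⟩ := hB.exists_subset_of_mem_open hx hu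
          exact ⟨v, hvB, (hB.isOpen hvB).mem_nhds hxv, hvu⟩) hG
        (r := Real.toNNReal q) (by
          rw [← ENNReal.coe_lt_coe, ProbabilityMeasure.ennreal_coeFn_eq_coeFn_toMeasure]
          exact hqG)
      rw [← ENNReal.coe_lt_coe, ProbabilityMeasure.ennreal_coeFn_eq_coeFn_toMeasure,
        ← Finset.set_biUnion_coe, ← Set.sUnion_eq_biUnion] at hTμ
      refine lt_of_lt_of_le hrq (le_liminf_of_le (by isBoundedDefault) ?_)
      filter_upwards [hs _ ⟨(↑T, q), ⟨⟨T.finite_toSet, fun t ht => hTB t ht⟩, trivial⟩, rfl⟩ hTμ]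
        with ν hν
      refine hν.le.trans (measure_mono ?_)
      rw [Set.sUnion_eq_biUnion, Finset.set_biUnion_coe]
      exact hTG
    have hsc : @SecondCountableTopology _ (TopologicalSpace.generateFrom gen) :=
      @SecondCountableTopology.mk _ (TopologicalSpace.generateFrom gen) ⟨gen, hgc, rfl⟩
    have hle : TopologicalSpace.generateFrom gen ≤
        (ProbabilityMeasure.instTopologicalSpace : TopologicalSpace (ProbabilityMeasure X)) := by
      refine le_of_nhds_le_nhds fun μ => hlim _ μ ?_ fun s hs hμ => ?_
      · exact @FirstCountableTopology.nhds_generated_countable _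
          (TopologicalSpace.generateFrom gen)
          (@TopologicalSpace.SecondCountableTopology.to_firstCountableTopology _
            (TopologicalSpace.generateFrom gen) hsc) μ
      · exact @IsOpen.mem_nhds _ (TopologicalSpace.generateFrom gen) μ s
          (TopologicalSpace.isOpen_generateFrom_of_mem hs) hμ
    have h1 : borel (ProbabilityMeasure X) ≤
        @borel _ (TopologicalSpace.generateFrom gen) :=
      MeasurableSpace.generateFrom_mono fun s hs => hle s hs
    rw [@borel_eq_generateFrom_of_subbasis _ gen (TopologicalSpace.generateFrom gen) hsc rfl] at h1
    exact h1.trans (MeasurableSpace.generateFrom_le hmeas)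

/-! ### The finite volume Gibbs states -/

/-- Mean-field Hamiltonian in an external field,
`H_n[φ] = -J/(2n) ∑_{i,j} φ_i φ_j - ∑_i h_i φ_i`. -/
noncomputable def hamiltonian (J : ℝ) (h : ℕ → ℝ) (n : ℕ) (φ : EuclideanSpace ℝ (Fin n)) : ℝ :=
  -(J / (2 * n)) * (∑ i : Fin n, ∑ j : Fin n, φ i * φ j) - (∑ i : Fin n, h i * φ i)

/-- Normalised surface measure `ω_n` on the sphere of radius `√n` in `ℝⁿ`. -/
noncomputable def uniformSphere (n : ℕ) : Measure (EuclideanSpace ℝ (Fin n)) :=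
  ((volume : Measure (EuclideanSpace ℝ (Fin n))).toSphere Set.univ)⁻¹ •
    (volume : Measure (EuclideanSpace ℝ (Fin n))).toSphere.map
      (fun Ω : Metric.sphere (0 : EuclideanSpace ℝ (Fin n)) 1 =>
        Real.sqrt n • (Ω : EuclideanSpace ℝ (Fin n)))

/-- Gibbs measure on `ℝⁿ`: density `e^{-β H_n} / Z_n` with respect to `ω_n`, where
`Z_n = ∫ e^{-β H_n} dω_n`. -/
noncomputable def gibbsMeasure (β J : ℝ) (h : ℕ → ℝ) (n : ℕ) :
    Measure (EuclideanSpace ℝ (Fin n)) :=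
  (uniformSphere n).tilted (fun φ => -β * hamiltonian J h n φ)

/-- Extension of a vector by zeros. -/
noncomputable def zeroExtend (n : ℕ) (φ : EuclideanSpace ℝ (Fin n)) : ℕ → ℝ :=
  fun i => if hi : i < n then φ ⟨i, hi⟩ else 0

theorem measurable_zeroExtend (n : ℕ) : Measurable (zeroExtend n) := by
  refine measurable_pi_lambda _ fun i => ?_
  unfold zeroExtend
  split_ifs <;> fun_prop

instance isProbabilityMeasure_uniformSphere (n : ℕ) [NeZero n] :
    IsProbabilityMeasure (uniformSphere n) := by
  constructor
  have hm : Measurable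
      (fun Ω : Metric.sphere (0 : EuclideanSpace ℝ (Fin n)) 1 =>
        Real.sqrt n • (Ω : EuclideanSpace ℝ (Fin n))) := by fun_prop
  rw [uniformSphere, Measure.smul_apply, Measure.map_apply hm MeasurableSet.univ,
    Set.preimage_univ, smul_eq_mul]
  exact ENNReal.inv_mul_cancel
    (Measure.measure_univ_ne_zero.2 (Measure.toSphere_ne_zero _)) (measure_ne_top _ _)

theorem continuous_hamiltonian (J : ℝ) (h : ℕ → ℝ) (n : ℕ) : Continuous (hamiltonian J h n) := by
  unfold hamiltonian
  fun_prop

theorem integrable_exp_hamiltonian (β J : ℝ) (h : ℕ → ℝ) (n : ℕ) [NeZero n] :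
    Integrable (fun φ => Real.exp (-β * hamiltonian J h n φ)) (uniformSphere n) := by
  have hc := continuous_hamiltonian J h n
  refine Integrable.smul_measure ?_
    (ENNReal.inv_ne_top.2 (Measure.measure_univ_ne_zero.2 (Measure.toSphere_ne_zero _)))
  have hs : Continuous (fun Ω : Metric.sphere (0 : EuclideanSpace ℝ (Fin n)) 1 =>
      Real.sqrt n • (Ω : EuclideanSpace ℝ (Fin n))) := by fun_prop
  have he : Continuous (fun φ => Real.exp (-β * hamiltonian J h n φ)) := by fun_prop
  refine (integrable_map_measure he.aestronglyMeasurable hs.measurable.aemeasurable).2 ?_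
  exact Continuous.integrable_of_hasCompactSupport (he.comp hs)
    (HasCompactSupport.of_compactSpace _)

instance isProbabilityMeasure_gibbsMeasure (β J : ℝ) (h : ℕ → ℝ) (n : ℕ) [NeZero n] :
    IsProbabilityMeasure (gibbsMeasure β J h n) :=
  isProbabilityMeasure_tilted (integrable_exp_hamiltonian β J h n)

/-- Finite volume Gibbs state `μ_n`, as a probability measure on `ℝ^ℕ`: all coordinates with
index `≥ n` are zero. The field and the spins are indexed from `0`. -/
noncomputable def gibbsState (β J : ℝ) (h : ℕ → ℝ) (n : ℕ) [NeZero n] :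
    ProbabilityMeasure (ℕ → ℝ) :=
  ⟨(gibbsMeasure β J h n).map (zeroExtend n),
    Measure.isProbabilityMeasure_map (measurable_zeroExtend n).aemeasurable⟩

/-- Newman-Stein (empirical) metastate `(1/N) ∑_{n=1}^N δ_{μ_n}`. -/
noncomputable def newmanSteinMetastate (β J : ℝ) (h : ℕ → ℝ) (N : ℕ) [NeZero N] :
    ProbabilityMeasure (ProbabilityMeasure (ℕ → ℝ)) :=
  ⟨(N : ENNReal)⁻¹ • ∑ k ∈ Finset.range N, Measure.dirac (gibbsState β J h (k + 1)), by
    constructor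
    simp [ENNReal.inv_mul_cancel, NeZero.ne N]⟩

/-! ### The limiting tilting function and the pure-state range -/

/-- The open unit disk of `ℝ²`. -/
def unitDisk : Set (ℝ × ℝ) := {z | z.1 ^ 2 + z.2 ^ 2 < 1}

/-- Limiting exponential tilting function `ψ(x, y) = βJx²/2 + β⟨m, z⟩ + ½ log(1 - ‖z‖²)`. -/
noncomputable def tiltingFunction (β J : ℝ) (m z : ℝ × ℝ) : ℝ :=
  β * J / 2 * z.1 ^ 2 + β * (m.1 * z.1 + m.2 * z.2) +
    1 / 2 * Real.log (1 - (z.1 ^ 2 + z.2 ^ 2))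

/-- Global maximising points of the limiting tilting function on the open unit disk. -/
def maximizers (β J : ℝ) (m : ℝ × ℝ) : Set (ℝ × ℝ) :=
  {z | z ∈ unitDisk ∧ ∀ w ∈ unitDisk, tiltingFunction β J m w ≤ tiltingFunction β J m z}

/-! ### The limiting states -/

/-- Standard Gaussian measure `η` on `ℝ^ℕ`. -/
noncomputable def stdGaussianSeq : Measure (ℕ → ℝ) :=
  Measure.infinitePi (fun _ : ℕ => gaussianReal 0 1)

/-- Transport map `φ ↦ √(1-‖z‖²) φ + x 1 + y (h - m₁ 1) / m₂`, where `z = (x, y)`. -/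
noncomputable def transportMap (m z : ℝ × ℝ) (h φ : ℕ → ℝ) : ℕ → ℝ :=
  fun i => Real.sqrt (1 - (z.1 ^ 2 + z.2 ^ 2)) * φ i + z.1 + z.2 * ((h i - m.1) / m.2)

theorem measurable_transportMap (m z : ℝ × ℝ) (h : ℕ → ℝ) : Measurable (transportMap m z h) := by
  unfold transportMap
  fun_prop

/-- The limiting state: the image of `η` under the transport map. -/
noncomputable def limitState (m z : ℝ × ℝ) (h : ℕ → ℝ) : ProbabilityMeasure (ℕ → ℝ) :=
  ⟨stdGaussianSeq.map (transportMap m z h),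
    haveI : IsProbabilityMeasure stdGaussianSeq := by unfold stdGaussianSeq; infer_instance
    Measure.isProbabilityMeasure_map (measurable_transportMap m z h).aemeasurable⟩

/-! ### The random external field -/

/-- The random field `h` has independent components distributed as `h₀`, which is square
integrable with positive variance. -/
structure IsIIDField {Ω Ω₀ : Type*} [MeasurableSpace Ω] [MeasurableSpace Ω₀]
    (P : Measure Ω) (P₀ : Measure Ω₀) (h : Ω → ℕ → ℝ) (h₀ : Ω₀ → ℝ) : Prop where
  measurable_field : Measurable h
  indep : iIndepFun (fun i ω => h ω i) P
  identDistrib : ∀ i, IdentDistrib (fun ω => h ω i) h₀ P P₀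
  memLp_two : MemLp h₀ 2 P₀
  variance_pos : 0 < variance h₀ P₀

/-- The pair (mean, standard deviation) of a real random variable. -/
noncomputable def meanSD {Ω₀ : Type*} [MeasurableSpace Ω₀] (P₀ : Measure Ω₀) (h₀ : Ω₀ → ℝ) :
    ℝ × ℝ :=
  (∫ ω, h₀ ω ∂P₀, Real.sqrt (variance h₀ P₀))

/-! ### Standard Gaussian vectors in polar coordinates -/

/-! Fix the field. On the sphere of radius `√n` the energy depends on a spin only through its
components along two orthonormal vectors, `onesDir` and the centred field `fieldDir`; everything
orthogonal to them stays uniformly distributed. The uniform law is the law of a normalised Gaussian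
vector `p₁ e₁ + p₂ e₂ + q`. In the gnomonic coordinates `t = p / ‖q‖` its density is a constant
times `(1 + |t|²) ^ (-n/2)`, and the direction of `q` is independent of `t`
(`lintegral_direction_stdGaussian`). With `z = diskPoint t` one has `1 - |z|² = (1 + |t|²)⁻¹`, so
this density is exactly the entropic factor `exp (n/2 · log (1 - |z|²))`. Hence a Gibbs expectation
is an average over the plane with weight `exp (n ψₙ)` and no further prefactor
(`integral_gibbsState`), where `ψₙ` is the tilting function at the empirical mean and standard
deviation of the field.

By the strong law these empirical parameters converge almost surely, and `ψₙ → ψ` uniformly because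
the parameters enter linearly against bounded coordinates. The unique maximiser is well separated
(`exists_tiltingFunction_gap`), so Laplace's method concentrates the weights at it
(`tendsto_integral_exp_mul_div`). The quantity being averaged, a Gaussian integral over the
orthogonal direction, must converge jointly in `n` and `t`. All dimensions are therefore driven by
one Gaussian sequence `g`: its projections on the two directions are `o(√n)` and its squared norm is
`n (1 + o(1))` almost surely, so each spin coordinate tends to that of `transportMap`.

Thus the Gibbs states converge for almost every field (`tendsto_gibbsState`). Convergence in
distribution follows at once, and the metastates converge because they are Cesàro means. -/

theorem lintegral_comp_smul_addHaar {E : Type*} [NormedAddCommGroup E] [NormedSpace ℝ E]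
    [FiniteDimensional ℝ E] [MeasurableSpace E] [BorelSpace E] (μ : Measure E)
    [μ.IsAddHaarMeasure] {c : ℝ} (hc : c ≠ 0) {H : E → ENNReal} (hH : Measurable H) :
    ∫⁻ x, H (c • x) ∂μ = ENNReal.ofReal |(c ^ Module.finrank ℝ E)⁻¹| * ∫⁻ x, H x ∂μ := by
  rw [← lintegral_map hH (measurable_const_smul c), Measure.map_addHaar_smul _ hc,
    lintegral_smul_measure, smul_eq_mul]

section Polar

variable {E : Type*} [NormedAddCommGroup E] [InnerProductSpace ℝ E] [FiniteDimensional ℝ E]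
  [MeasurableSpace E] [BorelSpace E]

/-- Density of the standard Gaussian measure with respect to Lebesgue measure. -/
theorem stdGaussian_eq_withDensity :
    ∃ c : ℝ, 0 < c ∧ stdGaussian E = (volume : Measure E).withDensity
      (fun x => ENNReal.ofReal (c * Real.exp (-‖x‖ ^ 2 / 2))) := by
  set A : ℝ := (2 * Real.pi) ^ ((Module.finrank ℝ E : ℝ) / 2) with hA
  have hA0 : 0 < A := by positivity
  have hhalf : 0 < (1 / 2 : ℂ).re := by norm_num
  have hAc : ((Real.pi : ℂ) / (1 / 2 : ℂ)) ^ ((Module.finrank ℝ E : ℂ) / 2) = (A : ℂ) := by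
    rw [hA, Complex.ofReal_cpow (by positivity)]
    push_cast
    congr 1
    ring
  refine ⟨A⁻¹, by positivity, ?_⟩
  have hI : Integrable (fun x : E => A⁻¹ * Real.exp (-‖x‖ ^ 2 / 2)) := by
    have := (GaussianFourier.integrable_cexp_neg_mul_sq_norm_add hhalf 0 (0 : E)).norm
    refine (this.congr (Eventually.of_forall fun x => ?_)).const_mul _
    simp only [Complex.norm_exp]
    congr 1
    simp [← Complex.ofReal_pow]
    ring
  have : IsFiniteMeasure ((volume : Measure E).withDensity
      (fun x => ENNReal.ofReal (A⁻¹ * Real.exp (-‖x‖ ^ 2 / 2)))) :=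
    isFiniteMeasure_withDensity_ofReal hI.2
  -- Only finiteness is needed here: equality of the characteristic functions also confirms the
  -- normalisation `A⁻¹`.
  apply Measure.ext_of_charFun
  ext t
  rw [charFun_stdGaussian, charFun_apply, integral_withDensity_eq_integral_toReal_smul
    (by fun_prop) (by simp)]
  have key := GaussianFourier.integral_cexp_neg_mul_sq_norm_add hhalf Complex.I t
  have : ∀ x : E, (ENNReal.ofReal (A⁻¹ * Real.exp (-‖x‖ ^ 2 / 2))).toReal •
      Complex.exp ((inner ℝ x t : ℝ) * Complex.I) =
      (A : ℂ)⁻¹ * Complex.exp (-(1 / 2) * (‖x‖ : ℂ) ^ 2 + Complex.I * (inner ℝ t x : ℝ)) := by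
    intro x
    rw [ENNReal.toReal_ofReal (by positivity), Complex.exp_add, real_inner_comm, Complex.real_smul]
    push_cast
    rw [mul_assoc]
    congr 2
    · congr 1; ring
    · congr 1; ring
  simp_rw [this]
  rw [integral_const_mul, key, hAc, ← mul_assoc, inv_mul_cancel₀ (by exact_mod_cast hA0.ne'),
    one_mul]
  congr 1
  rw [Complex.I_sq]
  ring

/-- Away from the origin, a null set, Lebesgue measure is the product of surface measure and a
radial measure. -/
theorem lintegral_polar [Nontrivial E] {G : ℝ → ENNReal} (hG : Measurable G)
    {F : E → ENNReal} (hF : Measurable F) :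
    ∫⁻ x : E, G ‖x‖ * F (‖x‖⁻¹ • x) =
      (∫⁻ r, G r ∂(Measure.volumeIoiPow (Module.finrank ℝ E - 1))) *
        ∫⁻ u, F u ∂(volume : Measure E).toSphere := by
  have h0 : (volume : Measure E) = volume.restrict {0}ᶜ := by
    rw [Measure.restrict_eq_self_of_ae_mem]
    exact compl_mem_ae_iff.2 (measure_singleton 0)
  rw [h0, ← lintegral_subtype_comap (measurableSet_singleton (0 : E)).compl, ← h0]
  have hmp := Measure.measurePreserving_homeomorphUnitSphereProd (volume : Measure E)
  have := hmp.lintegral_comp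
    (f := fun p : Metric.sphere (0 : E) 1 × Set.Ioi (0 : ℝ) => F p.1 * G p.2) (by fun_prop)
  rw [lintegral_prod_mul (f := fun u : Metric.sphere (0 : E) 1 => F u)
    (g := fun r : Set.Ioi (0 : ℝ) => G r) (hF.comp measurable_subtype_coe).aemeasurable
    (hG.comp measurable_subtype_coe).aemeasurable] at this
  rw [mul_comm, ← this]
  refine lintegral_congr fun x => ?_
  rw [mul_comm]
  simp

/-- Norm and direction of a standard Gaussian vector are independent, and the direction is
uniformly distributed on the unit sphere. -/
theorem lintegral_stdGaussian_norm_mul [Nontrivial E] {G : ℝ → ENNReal} (hG : Measurable G)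
    {F : E → ENNReal} (hF : Measurable F) :
    ∫⁻ x, G ‖x‖ * F (‖x‖⁻¹ • x) ∂stdGaussian E = (∫⁻ x, G ‖x‖ ∂stdGaussian E) *
      (((volume : Measure E).toSphere Set.univ)⁻¹ *
        ∫⁻ u, F u ∂(volume : Measure E).toSphere) := by
  obtain ⟨c, hc, hd⟩ := stdGaussian_eq_withDensity (E := E)
  let D : ℝ → ENNReal := fun r => ENNReal.ofReal (c * Real.exp (-r ^ 2 / 2))
  have hD : Measurable D := by fun_prop
  have h1 := lintegral_polar (hD.mul hG) hF
  -- Taking `F = 1` identifies the radial integral up to the total mass of the sphere, which is then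
  -- divided out.
  have h2 := lintegral_polar (E := E) (hD.mul hG) (F := fun _ => 1) measurable_const
  rw [hd, lintegral_withDensity_eq_lintegral_mul _ (by fun_prop) (by fun_prop),
    lintegral_withDensity_eq_lintegral_mul _ (by fun_prop) (by fun_prop)]
  simp only [Pi.mul_apply, mul_one, lintegral_one, D] at h1 h2 ⊢
  simp only [← mul_assoc] at h1 h2 ⊢
  rw [h1, h2]
  have hs0 : (volume : Measure E).toSphere Set.univ ≠ 0 :=
    Measure.measure_univ_ne_zero.2 (Measure.toSphere_ne_zero _)
  rw [mul_assoc _ (Measure.toSphere _ _) (Measure.toSphere _ _)⁻¹,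
    ENNReal.mul_inv_cancel hs0 (measure_ne_top _ _), mul_one]

theorem lintegral_stdGaussian_direction [Nontrivial E] {F : E → ENNReal} (hF : Measurable F) :
    ∫⁻ x, F (‖x‖⁻¹ • x) ∂stdGaussian E = ((volume : Measure E).toSphere Set.univ)⁻¹ *
        ∫⁻ u, F u ∂(volume : Measure E).toSphere := by
  simpa using lintegral_stdGaussian_norm_mul (G := fun _ => 1) measurable_const hF

theorem lintegral_stdGaussian_norm_mul_direction [Nontrivial E]
    {G : ℝ → ENNReal} (hG : Measurable G) {F : E → ENNReal} (hF : Measurable F) :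
    ∫⁻ x, G ‖x‖ * F (‖x‖⁻¹ • x) ∂stdGaussian E =
      (∫⁻ x, G ‖x‖ ∂stdGaussian E) * ∫⁻ x, F (‖x‖⁻¹ • x) ∂stdGaussian E := by
  rw [lintegral_stdGaussian_norm_mul hG hF, lintegral_stdGaussian_direction hF]

theorem ae_stdGaussian_ne_zero [Nontrivial E] : ∀ᵐ x ∂stdGaussian E, x ≠ 0 := by
  obtain ⟨c, hc, hd⟩ := stdGaussian_eq_withDensity (E := E)
  rw [hd]
  exact (withDensity_absolutelyContinuous _ _).ae_le (compl_mem_ae_iff.2 (measure_singleton 0))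

/-- Gaussian integral of `‖x‖² exp(-s‖x‖²/2)`. -/
theorem lintegral_stdGaussian_sq_mul_exp [Nontrivial E] :
    ∃ C : ENNReal, C ≠ 0 ∧ C ≠ ⊤ ∧ ∀ s : ℝ, 0 ≤ s →
      ∫⁻ x, ENNReal.ofReal (‖x‖ ^ 2 * Real.exp (-(s * ‖x‖ ^ 2) / 2)) ∂stdGaussian E =
        C * ENNReal.ofReal ((1 + s) ^ (-((Module.finrank ℝ E + 2 : ℕ) : ℝ) / 2)) := by
  obtain ⟨c, hc, hd⟩ := stdGaussian_eq_withDensity (E := E)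
  let K : E → ENNReal := fun x => ENNReal.ofReal (‖x‖ ^ 2)
  have hI : ∫⁻ x, K x ∂stdGaussian E ≠ ⊤ := by
    have h := (IsGaussian.memLp_id (stdGaussian E) 2 (by simp)).integrable_norm_pow (by simp)
    have := h.2
    rw [hasFiniteIntegral_iff_ofReal (Eventually.of_forall fun x => by positivity)] at this
    exact this.ne
  refine ⟨∫⁻ x, K x ∂stdGaussian E, ?_, hI, fun s hs => ?_⟩
  · rw [Ne, lintegral_eq_zero_iff (by fun_prop)]
    intro h
    have := h.and (ae_stdGaussian_ne_zero (E := E))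
    obtain ⟨x, hx, hx0⟩ := this.exists
    simp only [K, Pi.zero_apply, ENNReal.ofReal_eq_zero] at hx
    have := norm_pos_iff.2 hx0
    nlinarith [pow_pos this 2]
  · have hs1 : 0 < 1 + s := by linarith
    have hq : 0 < Real.sqrt (1 + s) := Real.sqrt_pos.2 hs1
    have hsq : Real.sqrt (1 + s) ^ 2 = 1 + s := Real.sq_sqrt hs1.le
    rw [hd, lintegral_withDensity_eq_lintegral_mul _ (by fun_prop) (by fun_prop),
      lintegral_withDensity_eq_lintegral_mul _ (by fun_prop) (by fun_prop)]
    -- The substitution `x ↦ √(1+s) x` absorbs `exp (-s‖x‖²/2)` into the Gaussian density. With `d`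
    -- the dimension, the Jacobian gives `(1+s) ^ (-d/2)` and the factor `‖x‖²` one more `(1+s)⁻¹`,
    -- whence the exponent `-(d+2)/2`.
    have h1 := lintegral_comp_smul_addHaar (volume : Measure E) hq.ne'
      (H := fun x => ENNReal.ofReal (c * Real.exp (-‖x‖ ^ 2 / 2)) * K x) (by fun_prop)
    have h2 : ∀ x : E, ENNReal.ofReal (c * Real.exp (-‖x‖ ^ 2 / 2)) *
        ENNReal.ofReal (‖x‖ ^ 2 * Real.exp (-(s * ‖x‖ ^ 2) / 2)) =
        ENNReal.ofReal (1 + s)⁻¹ * (ENNReal.ofReal (c * Real.exp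
          (-‖Real.sqrt (1 + s) • x‖ ^ 2 / 2)) * K (Real.sqrt (1 + s) • x)) := by
      intro x
      simp only [K]
      rw [← ENNReal.ofReal_mul (by positivity), ← ENNReal.ofReal_mul (by positivity),
        ← ENNReal.ofReal_mul (by positivity), norm_smul, Real.norm_of_nonneg hq.le, mul_pow, hsq]
      congr 1
      have : Real.exp (-((1 + s) * ‖x‖ ^ 2) / 2) =
          Real.exp (-‖x‖ ^ 2 / 2) * Real.exp (-(s * ‖x‖ ^ 2) / 2) := by
        rw [← Real.exp_add]; congr 1; ring
      rw [this]
      field_simp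
    simp only [Pi.mul_apply, h2]
    rw [lintegral_const_mul _ (by fun_prop), h1, ← mul_assoc, mul_comm]
    congr 1
    rw [← ENNReal.ofReal_mul (by positivity)]
    congr 1
    rw [abs_of_pos (by positivity), Real.sqrt_eq_rpow, ← Real.rpow_natCast, ← Real.rpow_mul hs1.le,
      ← Real.rpow_neg hs1.le, ← Real.rpow_neg_one (1 + s), ← Real.rpow_add hs1]
    congr 1
    push_cast
    ring

end Polar

/-! ### Splitting off two orthonormal directions -/

section Decomposition

variable {E : Type*} [NormedAddCommGroup E] [InnerProductSpace ℝ E]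

/-- Component of `g` orthogonal to the orthonormal pair `e₁, e₂`. -/
noncomputable def perp (e₁ e₂ g : E) : E := g - inner ℝ e₁ g • e₁ - inner ℝ e₂ g • e₂

/-- The point of the unit sphere with direction `u` orthogonal to `e₁, e₂` and projective
coordinates `t` along `e₁, e₂`. -/
noncomputable def spherePoint (e₁ e₂ : E) (t : ℝ × ℝ) (u : E) : E :=
  (Real.sqrt (1 + (t.1 ^ 2 + t.2 ^ 2)))⁻¹ • (t.1 • e₁ + t.2 • e₂ + ‖u‖⁻¹ • u)

variable {e₁ e₂ : E}

theorem inner_perp_left (h1 : ‖e₁‖ = 1) (h12 : inner ℝ e₁ e₂ = 0) (g : E) :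
    inner ℝ e₁ (perp e₁ e₂ g) = 0 := by
  simp [perp, inner_sub_right, inner_smul_right, h1, h12]

theorem inner_perp_right (h2 : ‖e₂‖ = 1) (h12 : inner ℝ e₁ e₂ = 0) (g : E) :
    inner ℝ e₂ (perp e₁ e₂ g) = 0 := by
  simp [perp, inner_sub_right, inner_smul_right, h2, real_inner_comm e₁ e₂, h12]

theorem norm_add_add_sq (h1 : ‖e₁‖ = 1) (h2 : ‖e₂‖ = 1) (h12 : inner ℝ e₁ e₂ = 0) {q : E}
    (hq1 : inner ℝ e₁ q = 0) (hq2 : inner ℝ e₂ q = 0) (a b : ℝ) :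
    ‖a • e₁ + b • e₂ + q‖ ^ 2 = a ^ 2 + b ^ 2 + ‖q‖ ^ 2 := by
  have e1 : inner ℝ (a • e₁ + b • e₂) q = 0 := by
    simp [inner_add_left, inner_smul_left, hq1, hq2]
  have e2 : inner ℝ (a • e₁) (b • e₂) = 0 := by
    simp [inner_smul_left, inner_smul_right, h12]
  rw [norm_add_sq_real, e1, norm_add_sq_real, e2, norm_smul, norm_smul, h1, h2]
  simp

theorem norm_perp_sq (h1 : ‖e₁‖ = 1) (h2 : ‖e₂‖ = 1) (h12 : inner ℝ e₁ e₂ = 0) (g : E) :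
    ‖perp e₁ e₂ g‖ ^ 2 = ‖g‖ ^ 2 - inner ℝ e₁ g ^ 2 - inner ℝ e₂ g ^ 2 := by
  have := norm_add_add_sq h1 h2 h12 (inner_perp_left h1 h12 g) (inner_perp_right h2 h12 g)
    (inner ℝ e₁ g) (inner ℝ e₂ g)
  have h : inner ℝ e₁ g • e₁ + inner ℝ e₂ g • e₂ + perp e₁ e₂ g = g := by
    unfold perp; abel
  rw [h] at this
  linarith

theorem perp_add_add (h1 : ‖e₁‖ = 1) (h2 : ‖e₂‖ = 1) (h12 : inner ℝ e₁ e₂ = 0) {q : E}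
    (hq1 : inner ℝ e₁ q = 0) (hq2 : inner ℝ e₂ q = 0) (a b : ℝ) :
    perp e₁ e₂ (a • e₁ + b • e₂ + q) = q := by
  have : a • e₁ + b • e₂ + q - a • e₁ - b • e₂ = q := by abel
  simpa [perp, inner_add_right, inner_smul_right, h1, h2, h12, real_inner_comm e₁ e₂, hq1, hq2] using this

theorem inner_spherePoint_left (h1 : ‖e₁‖ = 1) (h12 : inner ℝ e₁ e₂ = 0) {u : E}
    (hu : inner ℝ e₁ u = 0) (t : ℝ × ℝ) :
    inner ℝ e₁ (spherePoint e₁ e₂ t u) = (Real.sqrt (1 + (t.1 ^ 2 + t.2 ^ 2)))⁻¹ * t.1 := by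
  simp [spherePoint, inner_add_right, inner_smul_right, h1, h12, hu]

theorem inner_spherePoint_right (h2 : ‖e₂‖ = 1) (h12 : inner ℝ e₁ e₂ = 0) {u : E}
    (hu : inner ℝ e₂ u = 0) (t : ℝ × ℝ) :
    inner ℝ e₂ (spherePoint e₁ e₂ t u) = (Real.sqrt (1 + (t.1 ^ 2 + t.2 ^ 2)))⁻¹ * t.2 := by
  simp [spherePoint, inner_add_right, inner_smul_right, h2, real_inner_comm e₁ e₂, h12, hu]

/-- All three components scale with `‖q‖`, so normalising leaves only the direction of `q`. This
separates `t` from the orthogonal direction. -/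
theorem normalize_add_add (h1 : ‖e₁‖ = 1) (h2 : ‖e₂‖ = 1) (h12 : inner ℝ e₁ e₂ = 0) {q : E}
    (hq1 : inner ℝ e₁ q = 0) (hq2 : inner ℝ e₂ q = 0) (hq : q ≠ 0) (t : ℝ × ℝ) :
    ‖(‖q‖ * t.1) • e₁ + (‖q‖ * t.2) • e₂ + q‖⁻¹ • ((‖q‖ * t.1) • e₁ + (‖q‖ * t.2) • e₂ + q) =
      spherePoint e₁ e₂ t q := by
  have hr : 0 < ‖q‖ := norm_pos_iff.2 hq
  have hn : ‖(‖q‖ * t.1) • e₁ + (‖q‖ * t.2) • e₂ + q‖ =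
      ‖q‖ * Real.sqrt (1 + (t.1 ^ 2 + t.2 ^ 2)) := by
    rw [← Real.sqrt_sq (norm_nonneg _), norm_add_add_sq h1 h2 h12 hq1 hq2,
      ← Real.sqrt_sq hr.le, ← Real.sqrt_mul (by positivity), Real.sqrt_sq hr.le]
    congr 1
    ring
  rw [hn, spherePoint, mul_inv_rev, mul_smul]
  congr 1
  simp only [smul_add, smul_smul]
  rw [← mul_assoc, ← mul_assoc, inv_mul_cancel₀ hr.ne', one_mul, one_mul]

theorem mem_orthogonal_span_pair {q : E} :
    q ∈ (Submodule.span ℝ {e₁, e₂})ᗮ ↔ inner ℝ e₁ q = 0 ∧ inner ℝ e₂ q = 0 := by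
  rw [Submodule.mem_orthogonal]
  constructor
  · exact fun h => ⟨h _ (Submodule.subset_span (by simp)), h _ (Submodule.subset_span (by simp))⟩
  · rintro ⟨h1, h2⟩ u hu
    obtain ⟨a, b, rfl⟩ := Submodule.mem_span_pair.1 hu
    simp [inner_add_left, inner_smul_left, h1, h2]

variable [FiniteDimensional ℝ E] [MeasurableSpace E] [BorelSpace E]

/-- A standard Gaussian vector is the sum of independent standard Gaussians along `e₁`, `e₂` and
in the orthogonal complement. -/
theorem map_prod_stdGaussian (h1 : ‖e₁‖ = 1) (h2 : ‖e₂‖ = 1) (h12 : inner ℝ e₁ e₂ = 0) :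
    (((gaussianReal 0 1).prod (gaussianReal 0 1)).prod
      (stdGaussian (Submodule.span ℝ {e₁, e₂})ᗮ)).map
        (fun p => p.1.1 • e₁ + p.1.2 • e₂ + (p.2 : E)) = stdGaussian E := by
  have hm : Measurable (fun p : (ℝ × ℝ) × (Submodule.span ℝ {e₁, e₂})ᗮ =>
      p.1.1 • e₁ + p.1.2 • e₂ + (p.2 : E)) := by fun_prop
  have : IsProbabilityMeasure ((((gaussianReal 0 1).prod (gaussianReal 0 1)).prod
      (stdGaussian (Submodule.span ℝ {e₁, e₂})ᗮ)).map
        (fun p => p.1.1 • e₁ + p.1.2 • e₂ + (p.2 : E))) :=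
    Measure.isProbabilityMeasure_map hm.aemeasurable
  apply Measure.ext_of_charFun
  ext s
  -- The projection of the frequency `s` to the complement: the characteristic function splits into
  -- three factors, and Pythagoras reassembles `‖s‖²`.
  let s' : (Submodule.span ℝ {e₁, e₂})ᗮ := ⟨perp e₁ e₂ s, mem_orthogonal_span_pair.2
    ⟨inner_perp_left h1 h12 s, inner_perp_right h2 h12 s⟩⟩
  rw [charFun_stdGaussian, charFun_apply, integral_map hm.aemeasurable (by fun_prop)]
  have hf : ∀ p : (ℝ × ℝ) × (Submodule.span ℝ {e₁, e₂})ᗮ,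
      Complex.exp ((inner ℝ (p.1.1 • e₁ + p.1.2 • e₂ + (p.2 : E)) s : ℝ) * Complex.I) =
      (Complex.exp ((inner ℝ e₁ s : ℝ) * p.1.1 * Complex.I) *
        Complex.exp ((inner ℝ e₂ s : ℝ) * p.1.2 * Complex.I)) *
        Complex.exp ((inner ℝ p.2 s' : ℝ) * Complex.I) := by
    intro p
    obtain ⟨hp1, hp2⟩ := mem_orthogonal_span_pair.1 p.2.2
    have : inner ℝ p.2 s' = inner ℝ (p.2 : E) s := by
      rw [real_inner_comm] at hp1 hp2
      rw [Submodule.coe_inner]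
      change inner ℝ (p.2 : E) (perp e₁ e₂ s) = _
      rw [perp, inner_sub_right, inner_sub_right, inner_smul_right, inner_smul_right, hp1, hp2]
      simp
    rw [this, ← Complex.exp_add, ← Complex.exp_add, inner_add_left, inner_add_left,
      real_inner_smul_left, real_inner_smul_left]
    congr 1
    push_cast
    ring
  simp_rw [hf]
  rw [integral_prod_mul (f := fun p : ℝ × ℝ => Complex.exp ((inner ℝ e₁ s : ℝ) * p.1 * Complex.I) *
        Complex.exp ((inner ℝ e₂ s : ℝ) * p.2 * Complex.I))
      (g := fun q : (Submodule.span ℝ {e₁, e₂})ᗮ =>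
        Complex.exp ((inner ℝ q s' : ℝ) * Complex.I)),
    integral_prod_mul (f := fun a : ℝ => Complex.exp ((inner ℝ e₁ s : ℝ) * a * Complex.I))
      (g := fun b : ℝ => Complex.exp ((inner ℝ e₂ s : ℝ) * b * Complex.I)),
    ← charFun_apply_real, ← charFun_apply_real, ← charFun_apply, charFun_stdGaussian,
    charFun_gaussianReal, charFun_gaussianReal, ← Complex.exp_add, ← Complex.exp_add]
  congr 1
  have hs : ‖s'‖ ^ 2 = ‖s‖ ^ 2 - inner ℝ e₁ s ^ 2 - inner ℝ e₂ s ^ 2 := norm_perp_sq h1 h2 h12 s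
  have hs' := congrArg (fun x : ℝ => (x : ℂ)) hs
  push_cast at hs' ⊢
  rw [hs']
  ring

/-- In the splitting of `map_prod_stdGaussian`, `perp` reads off the third component. The Gaussian
on the complement, a subspace depending on the field, can thus be replaced by a projected Gaussian
on the whole space. -/
theorem lintegral_perp_stdGaussian (h1 : ‖e₁‖ = 1) (h2 : ‖e₂‖ = 1) (h12 : inner ℝ e₁ e₂ = 0)
    {F : E → ENNReal} (hF : Measurable F) :
    ∫⁻ g, F (perp e₁ e₂ g) ∂stdGaussian E =
      ∫⁻ q : (Submodule.span ℝ {e₁, e₂})ᗮ, F q ∂stdGaussian _ := by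
  have hp : Measurable (perp e₁ e₂) := by unfold perp; fun_prop
  rw [← map_prod_stdGaussian h1 h2 h12, lintegral_map (f := fun x => F (perp e₁ e₂ x)) (hF.comp hp) (by fun_prop)]
  have : ∀ p : (ℝ × ℝ) × (Submodule.span ℝ {e₁, e₂})ᗮ,
      F (perp e₁ e₂ (p.1.1 • e₁ + p.1.2 • e₂ + (p.2 : E))) = F p.2 := fun p => by
    obtain ⟨hp1, hp2⟩ := mem_orthogonal_span_pair.1 p.2.2
    rw [perp_add_add h1 h2 h12 hp1 hp2]
  simp_rw [this]
  rw [lintegral_prod_symm' _ (by fun_prop)]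
  simp

theorem gaussianReal_prod_eq_withDensity :
    (gaussianReal 0 1).prod (gaussianReal 0 1) = (volume : Measure (ℝ × ℝ)).withDensity
      (fun p => ENNReal.ofReal ((2 * Real.pi)⁻¹ * Real.exp (-(p.1 ^ 2 + p.2 ^ 2) / 2))) := by
  rw [gaussianReal_of_var_ne_zero 0 one_ne_zero, prod_withDensity (by fun_prop) (by fun_prop),
    ← Measure.volume_eq_prod]
  congr 1
  ext p
  rw [gaussianPDF_def, ← ENNReal.ofReal_mul (gaussianPDFReal_nonneg _ _ _), gaussianPDFReal_def]
  congr 1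
  have hs : (Real.sqrt (2 * Real.pi * (1 : NNReal)))⁻¹ * (Real.sqrt (2 * Real.pi * (1 : NNReal)))⁻¹
      = (2 * Real.pi)⁻¹ := by
    rw [← mul_inv, Real.mul_self_sqrt (by positivity)]
    simp
  rw [mul_mul_mul_comm, hs, ← Real.exp_add]
  congr 2
  simp
  ring

/-- Disintegration of the uniform distribution on the unit sphere along two orthonormal
directions, in projective coordinates. -/
theorem lintegral_direction_stdGaussian (h1 : ‖e₁‖ = 1) (h2 : ‖e₂‖ = 1)
    (h12 : inner ℝ e₁ e₂ = 0) (hE : 3 ≤ Module.finrank ℝ E) :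
    ∃ C : ENNReal, C ≠ 0 ∧ C ≠ ⊤ ∧ ∀ F : E → ENNReal, Measurable F →
      ∫⁻ x, F (‖x‖⁻¹ • x) ∂stdGaussian E =
        C * ∫⁻ t : ℝ × ℝ, ENNReal.ofReal
          ((1 + (t.1 ^ 2 + t.2 ^ 2)) ^ (-(Module.finrank ℝ E : ℝ) / 2)) *
            ∫⁻ g, F (spherePoint e₁ e₂ t (perp e₁ e₂ g)) ∂stdGaussian E := by
  set K : Submodule ℝ E := (Submodule.span ℝ {e₁, e₂})ᗮ with hK
  have horth : Orthonormal ℝ ![e₁, e₂] := by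
    simp [orthonormal_vecCons_iff, h1, h2, h12]
  have hdim : Module.finrank ℝ K + 2 = Module.finrank ℝ E := by
    have hspan : Module.finrank ℝ (Submodule.span ℝ {e₁, e₂}) = 2 := by
      have := finrank_span_eq_card horth.linearIndependent
      have hr : Set.range ![e₁, e₂] = {e₁, e₂} := by simp [Matrix.range_cons, Set.pair_comm]
      rw [hr] at this
      simpa using this
    rw [← Submodule.finrank_add_finrank_orthogonal (Submodule.span ℝ {e₁, e₂}), hspan, add_comm]
  have hKn : Nontrivial K := Module.nontrivial_of_finrank_pos (R := ℝ) (by omega)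
  obtain ⟨C, hC0, hCt, hC⟩ := lintegral_stdGaussian_sq_mul_exp (E := K)
  refine ⟨ENNReal.ofReal (2 * Real.pi)⁻¹ * C,
    mul_ne_zero (by simp [Real.pi_pos]) hC0, ENNReal.mul_ne_top ENNReal.ofReal_ne_top hCt,
    fun F hF => ?_⟩
  have hsp : Measurable (fun p : (ℝ × ℝ) × E => spherePoint e₁ e₂ p.1 p.2) := by
    unfold spherePoint; fun_prop
  -- For fixed `q`, substitute `p = ‖q‖ t`: the Jacobian in the plane is `‖q‖²`, and the planar
  -- Gaussian density becomes `exp (-|t|²‖q‖²/2)` up to its constant.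
  have hscale : ∀ q : K, q ≠ 0 →
      ∫⁻ p : ℝ × ℝ, F (‖p.1 • e₁ + p.2 • e₂ + (q : E)‖⁻¹ • (p.1 • e₁ + p.2 • e₂ + (q : E)))
          ∂((gaussianReal 0 1).prod (gaussianReal 0 1)) =
      ∫⁻ t : ℝ × ℝ, ENNReal.ofReal (2 * Real.pi)⁻¹ *
        (ENNReal.ofReal (‖q‖ ^ 2 * Real.exp (-((t.1 ^ 2 + t.2 ^ 2) * ‖q‖ ^ 2) / 2)) *
          F (spherePoint e₁ e₂ t q)) := by
    intro q hq
    have hq' : (q : E) ≠ 0 := by simpa using hq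
    have hr : 0 < ‖q‖ := norm_pos_iff.2 hq
    obtain ⟨hq1, hq2⟩ := mem_orthogonal_span_pair.1 q.2
    rw [gaussianReal_prod_eq_withDensity, lintegral_withDensity_eq_lintegral_mul _
      (by fun_prop) (by fun_prop)]
    have hs := lintegral_comp_smul_addHaar (volume : Measure (ℝ × ℝ)) hr.ne'
      (H := fun p => ENNReal.ofReal ((2 * Real.pi)⁻¹ * Real.exp (-(p.1 ^ 2 + p.2 ^ 2) / 2)) *
        F (‖p.1 • e₁ + p.2 • e₂ + (q : E)‖⁻¹ • (p.1 • e₁ + p.2 • e₂ + (q : E)))) (by fun_prop)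
    have hfr : Module.finrank ℝ (ℝ × ℝ) = 2 := by simp
    rw [hfr, abs_of_pos (by positivity)] at hs
    simp only [Pi.mul_apply]
    have hs' := congrArg (fun y => ENNReal.ofReal (‖q‖ ^ 2) * y) hs
    simp only [← mul_assoc] at hs'
    rw [← ENNReal.ofReal_mul (by positivity), mul_inv_cancel₀ (by positivity),
      ENNReal.ofReal_one, one_mul, ← lintegral_const_mul _ (by fun_prop)] at hs'
    rw [← hs']
    refine lintegral_congr fun t => ?_
    have hn := normalize_add_add h1 h2 h12 hq1 hq2 hq' t
    simp only [Submodule.coe_norm] at hn ⊢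
    simp only [Prod.smul_fst, Prod.smul_snd, smul_eq_mul]
    rw [hn, ← mul_assoc, ← mul_assoc, ← ENNReal.ofReal_mul (by positivity),
      ← ENNReal.ofReal_mul (by positivity)]
    congr 2
    rw [← mul_assoc, mul_comm (‖(q : E)‖ ^ 2), mul_assoc]
    congr 4
    ring
  have hm : Measurable (fun p : (ℝ × ℝ) × K =>
      F (‖p.1.1 • e₁ + p.1.2 • e₂ + (p.2 : E)‖⁻¹ • (p.1.1 • e₁ + p.1.2 • e₂ + (p.2 : E)))) := by
    fun_prop
  -- Integrate over `p` first, change variables for almost every `q`, then exchange the integrals so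
  -- that `t` is outermost.
  rw [← map_prod_stdGaussian h1 h2 h12, lintegral_map (by fun_prop) (by fun_prop),
    lintegral_prod_symm' _ hm, map_prod_stdGaussian h1 h2 h12,
    lintegral_congr_ae ((ae_stdGaussian_ne_zero (E := K)).mono hscale),
    lintegral_lintegral_swap (by unfold spherePoint; fun_prop), mul_assoc,
    lintegral_congr (g := fun t : ℝ × ℝ => ENNReal.ofReal (2 * Real.pi)⁻¹ * (C * (ENNReal.ofReal
      ((1 + (t.1 ^ 2 + t.2 ^ 2)) ^ (-(Module.finrank ℝ E : ℝ) / 2)) *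
        ∫⁻ g, F (spherePoint e₁ e₂ t (perp e₁ e₂ g)) ∂stdGaussian E)))]
  · have hm2 : Measurable (fun t : ℝ × ℝ =>
        ∫⁻ g, F (spherePoint e₁ e₂ t (perp e₁ e₂ g)) ∂stdGaussian E) :=
      Measurable.lintegral_prod_right' (f := fun p : (ℝ × ℝ) × E =>
        F (spherePoint e₁ e₂ p.1 (perp e₁ e₂ p.2))) (by unfold spherePoint perp; fun_prop)
    rw [lintegral_const_mul _ (by fun_prop), lintegral_const_mul _ (by fun_prop)]
  -- For fixed `t`, norm and direction of `q` are independent. The radial integral is the Gaussian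
  -- one with `s = |t|²`, and since the complement has codimension two its exponent is minus half
  -- the full dimension.
  · intro t
    have hF1 : Measurable (fun g : E => F (spherePoint e₁ e₂ t g)) := by
      unfold spherePoint; fun_prop
    rw [lintegral_perp_stdGaussian h1 h2 h12 hF1, lintegral_const_mul _ (by fun_prop), ← mul_assoc C,
      ← hdim, ← hC _ (by positivity)]
    congr 1
    exact lintegral_stdGaussian_norm_mul_direction (E := K)
      (G := fun r => ENNReal.ofReal (r ^ 2 * Real.exp (-((t.1 ^ 2 + t.2 ^ 2) * r ^ 2) / 2)))
      (by fun_prop) (F := fun u : K => F ((Real.sqrt (1 + (t.1 ^ 2 + t.2 ^ 2)))⁻¹ •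
        (t.1 • e₁ + t.2 • e₂ + (u : E)))) (by fun_prop)

end Decomposition

/-! ### Representation of the Gibbs states -/

/-- Empirical mean of the first `n` fields. -/
noncomputable def fieldMean (h : ℕ → ℝ) (n : ℕ) : ℝ := (∑ i ∈ Finset.range n, h i) / n

/-- Empirical standard deviation of the first `n` fields. -/
noncomputable def fieldSD (h : ℕ → ℝ) (n : ℕ) : ℝ :=
  Real.sqrt ((∑ i ∈ Finset.range n, h i ^ 2) / n - fieldMean h n ^ 2)

/-- Unit vector in the direction of `(1, …, 1)`. -/
noncomputable def onesDir (n : ℕ) : EuclideanSpace ℝ (Fin n) :=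
  WithLp.toLp 2 fun _ => (Real.sqrt n)⁻¹

/-- Unit vector in the direction of the centred field. -/
noncomputable def fieldDir (h : ℕ → ℝ) (n : ℕ) : EuclideanSpace ℝ (Fin n) :=
  WithLp.toLp 2 fun i => (Real.sqrt n)⁻¹ * ((h i - fieldMean h n) / fieldSD h n)

/-- Inverse of the gnomonic coordinates of the disk. -/
noncomputable def diskPoint (t : ℝ × ℝ) : ℝ × ℝ :=
  ((Real.sqrt (1 + (t.1 ^ 2 + t.2 ^ 2)))⁻¹ * t.1, (Real.sqrt (1 + (t.1 ^ 2 + t.2 ^ 2)))⁻¹ * t.2)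

/-- The first `n` coordinates of a sequence. -/
noncomputable def truncate (n : ℕ) (g : ℕ → ℝ) : EuclideanSpace ℝ (Fin n) :=
  WithLp.toLp 2 fun i => g i

/-- The point of the sphere of radius `√n` with gnomonic coordinates `t` along the mean and
field directions. -/
noncomputable def spin (h : ℕ → ℝ) (n : ℕ) (t : ℝ × ℝ) (g : EuclideanSpace ℝ (Fin n)) :
    EuclideanSpace ℝ (Fin n) :=
  Real.sqrt n • spherePoint (onesDir n) (fieldDir h n) t (perp (onesDir n) (fieldDir h n) g)

theorem norm_onesDir (n : ℕ) [NeZero n] : ‖onesDir n‖ = 1 := by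
  have hn : (0 : ℝ) < n := by exact_mod_cast NeZero.pos n
  rw [onesDir, EuclideanSpace.norm_eq]
  simp [hn.le, hn.ne']

theorem sum_sub_fieldMean_sq (h : ℕ → ℝ) (n : ℕ) [NeZero n] :
    ∑ i : Fin n, (h i - fieldMean h n) ^ 2 =
      n * ((∑ i ∈ Finset.range n, h i ^ 2) / n - fieldMean h n ^ 2) := by
  have hn : (n : ℝ) ≠ 0 := by exact_mod_cast NeZero.ne n
  have h1 : ∑ i ∈ Finset.range n, h i = n * fieldMean h n := by
    rw [fieldMean]; field_simp
  rw [Fin.sum_univ_eq_sum_range (fun i => (h i - fieldMean h n) ^ 2)]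
  simp_rw [sub_sq]
  rw [Finset.sum_add_distrib, Finset.sum_sub_distrib, ← Finset.sum_mul, ← Finset.mul_sum, h1]
  simp
  field_simp
  ring

theorem norm_fieldDir (h : ℕ → ℝ) (n : ℕ) [NeZero n] (hs : 0 < fieldSD h n) :
    ‖fieldDir h n‖ = 1 := by
  have hn : (0 : ℝ) < n := by exact_mod_cast NeZero.pos n
  have hsq : fieldSD h n ^ 2 = (∑ i ∈ Finset.range n, h i ^ 2) / n - fieldMean h n ^ 2 :=
    Real.sq_sqrt (Real.sqrt_pos.1 hs).le
  rw [fieldDir, EuclideanSpace.norm_eq]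
  simp only [Real.norm_eq_abs, sq_abs, mul_pow, div_pow, inv_pow, Real.sq_sqrt hn.le]
  rw [← Finset.mul_sum, ← Finset.sum_div, sum_sub_fieldMean_sq, ← hsq]
  field_simp
  simp

theorem inner_onesDir (n : ℕ) (g : EuclideanSpace ℝ (Fin n)) :
    inner ℝ (onesDir n) g = (Real.sqrt n)⁻¹ * ∑ i, g i := by
  simp only [onesDir, PiLp.inner_apply, Finset.mul_sum]
  exact Finset.sum_congr rfl fun i _ => mul_comm _ _

theorem inner_fieldDir (h : ℕ → ℝ) (n : ℕ) (g : EuclideanSpace ℝ (Fin n)) :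
    inner ℝ (fieldDir h n) g =
      (Real.sqrt n)⁻¹ * ((∑ i : Fin n, h i * g i - fieldMean h n * ∑ i, g i) / fieldSD h n) := by
  simp only [fieldDir, PiLp.inner_apply, Finset.mul_sum, ← Finset.sum_sub_distrib, Finset.sum_div]
  refine Finset.sum_congr rfl fun i _ => ?_
  simp
  ring

theorem inner_onesDir_fieldDir (h : ℕ → ℝ) (n : ℕ) [NeZero n] :
    inner ℝ (onesDir n) (fieldDir h n) = 0 := by
  have hn : (n : ℝ) ≠ 0 := by exact_mod_cast NeZero.ne n
  rw [inner_onesDir]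
  simp only [fieldDir, ← Finset.mul_sum, ← Finset.sum_div, Finset.sum_sub_distrib]
  rw [Fin.sum_univ_eq_sum_range (fun i => h i)]
  have : ∑ i ∈ Finset.range n, h i = n * fieldMean h n := by
    rw [fieldMean]; field_simp
  simp [this]

/-- The interaction is the square of `∑ φ i`, a multiple of the component along `onesDir`; splitting
`h` into its mean and its centred part writes the field term through both components. The radius
`√n` makes every term proportional to `n`. -/
theorem neg_mul_hamiltonian_smul (β J : ℝ) (h : ℕ → ℝ) (n : ℕ) [NeZero n] (hs : 0 < fieldSD h n)
    (v : EuclideanSpace ℝ (Fin n)) :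
    -β * hamiltonian J h n (Real.sqrt n • v) = n * (β * J / 2 * inner ℝ (onesDir n) v ^ 2 +
      β * (fieldMean h n * inner ℝ (onesDir n) v + fieldSD h n * inner ℝ (fieldDir h n) v)) := by
  have hn : (0 : ℝ) < n := by exact_mod_cast NeZero.pos n
  have hr : 0 < Real.sqrt n := Real.sqrt_pos.2 hn
  have hsq : Real.sqrt n ^ 2 = n := Real.sq_sqrt hn.le
  rw [inner_onesDir, inner_fieldDir, hamiltonian]
  simp only [PiLp.smul_apply, smul_eq_mul]
  have h1 : ∑ i : Fin n, ∑ j : Fin n, Real.sqrt n * v i * (Real.sqrt n * v j) =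
      n * (∑ i, v i) ^ 2 := by
    rw [sq (∑ i, v i), Finset.sum_mul_sum, Finset.mul_sum]
    refine Finset.sum_congr rfl fun i _ => ?_
    rw [Finset.mul_sum]
    refine Finset.sum_congr rfl fun j _ => ?_
    rw [mul_mul_mul_comm, Real.mul_self_sqrt hn.le]
  have h2 : ∑ i : Fin n, h i * (Real.sqrt n * v i) = Real.sqrt n * ∑ i : Fin n, h i * v i := by
    rw [Finset.mul_sum]
    exact Finset.sum_congr rfl fun i _ => by ring
  rw [h1, h2]
  generalize (∑ i, v i) = S
  generalize (∑ i : Fin n, h i * v i) = T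
  have h3 : (Real.sqrt n)⁻¹ = Real.sqrt n / n := by
    rw [eq_div_iff hn.ne', inv_mul_eq_iff_eq_mul₀ hr.ne', Real.mul_self_sqrt hn.le]
  rw [h3]
  have h4 : (Real.sqrt n / n * S) ^ 2 = S ^ 2 / n := by
    rw [mul_pow, div_pow, hsq]; field_simp
  rw [h4]
  field_simp
  ring

theorem norm_diskPoint_sq (t : ℝ × ℝ) :
    1 - ((diskPoint t).1 ^ 2 + (diskPoint t).2 ^ 2) = (1 + (t.1 ^ 2 + t.2 ^ 2))⁻¹ := by
  have hp : 0 < 1 + (t.1 ^ 2 + t.2 ^ 2) := by positivity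
  simp only [diskPoint, mul_pow, inv_pow, Real.sq_sqrt hp.le]
  field_simp
  ring

/-- The logarithm in the tilting function reproduces exactly the density of the uniform sphere in
gnomonic coordinates. -/
theorem exp_tiltingFunction_diskPoint (β J : ℝ) (m t : ℝ × ℝ) (n : ℕ) :
    Real.exp (n * tiltingFunction β J m (diskPoint t)) =
      (1 + (t.1 ^ 2 + t.2 ^ 2)) ^ (-(n : ℝ) / 2) *
        Real.exp (n * (β * J / 2 * (diskPoint t).1 ^ 2 +
          β * (m.1 * (diskPoint t).1 + m.2 * (diskPoint t).2))) := by
  have hp : 0 < 1 + (t.1 ^ 2 + t.2 ^ 2) := by positivity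
  rw [tiltingFunction, norm_diskPoint_sq, Real.log_inv, Real.rpow_def_of_pos hp, ← Real.exp_add]
  congr 1
  ring

theorem neg_mul_hamiltonian_spin (β J : ℝ) (h : ℕ → ℝ) (n : ℕ) [NeZero n] (hs : 0 < fieldSD h n)
    (t : ℝ × ℝ) (g : EuclideanSpace ℝ (Fin n)) :
    -β * hamiltonian J h n (spin h n t g) = n * (β * J / 2 * (diskPoint t).1 ^ 2 +
      β * (fieldMean h n * (diskPoint t).1 + fieldSD h n * (diskPoint t).2)) := by
  have h1 := norm_onesDir n
  have h2 := norm_fieldDir h n hs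
  have h12 := inner_onesDir_fieldDir h n
  rw [spin, neg_mul_hamiltonian_smul β J h n hs,
    inner_spherePoint_left h1 h12 (inner_perp_left h1 h12 g),
    inner_spherePoint_right h2 h12 (inner_perp_right h2 h12 g), diskPoint]

theorem measurable_spin (h : ℕ → ℝ) (n : ℕ) :
    Measurable (fun p : (ℝ × ℝ) × EuclideanSpace ℝ (Fin n) => spin h n p.1 p.2) := by
  unfold spin spherePoint perp; fun_prop

theorem lintegral_uniformSphere (n : ℕ) [NeZero n] {F : EuclideanSpace ℝ (Fin n) → ENNReal}
    (hF : Measurable F) :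
    ∫⁻ φ, F φ ∂uniformSphere n = ∫⁻ x, F (Real.sqrt n • (‖x‖⁻¹ • x)) ∂stdGaussian _ := by
  rw [lintegral_stdGaussian_direction (F := fun x => F (Real.sqrt n • x)) (by fun_prop),
    uniformSphere, lintegral_smul_measure, lintegral_map hF (by fun_prop), smul_eq_mul]

/-- The uniform distribution on the sphere of radius `√n` in gnomonic coordinates. -/
theorem uniformSphere_eq_map (h : ℕ → ℝ) (n : ℕ) [NeZero n] (hn : 3 ≤ n) (hs : 0 < fieldSD h n) :
    ∃ C : ENNReal, C ≠ 0 ∧ C ≠ ⊤ ∧ uniformSphere n = C • (((volume : Measure (ℝ × ℝ)).withDensity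
      (fun t => ENNReal.ofReal ((1 + (t.1 ^ 2 + t.2 ^ 2)) ^ (-(n : ℝ) / 2)))).prod
        (stdGaussian (EuclideanSpace ℝ (Fin n)))).map (fun p => spin h n p.1 p.2) := by
  obtain ⟨C, hC0, hCt, hC⟩ := lintegral_direction_stdGaussian (norm_onesDir n)
    (norm_fieldDir h n hs) (inner_onesDir_fieldDir h n) (by simpa using hn)
  refine ⟨C, hC0, hCt, ?_⟩
  rw [finrank_euclideanSpace_fin] at hC
  refine Measure.ext_of_lintegral _ fun F hF => ?_
  have hm := measurable_spin h n
  rw [lintegral_uniformSphere n hF, hC (fun x => F (Real.sqrt n • x)) (by fun_prop),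
    lintegral_smul_measure, lintegral_map hF hm, lintegral_prod (fun p => F (spin h n p.1 p.2)) (hF.comp hm).aemeasurable,
    lintegral_withDensity_eq_lintegral_mul _ (by fun_prop)
      (Measurable.lintegral_prod_right' (f := fun p : (ℝ × ℝ) × EuclideanSpace ℝ (Fin n) =>
        F (spin h n p.1 p.2)) (hF.comp hm))]
  rfl

/-- The constant stays unidentified because it cancels between a Gibbs numerator and the partition
function. -/
theorem integral_uniformSphere (h : ℕ → ℝ) (n : ℕ) [NeZero n] (hn : 3 ≤ n)
    (hs : 0 < fieldSD h n) :
    ∃ C : ℝ, C ≠ 0 ∧ ∀ F : EuclideanSpace ℝ (Fin n) → ℝ, Measurable F →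
      Integrable F (uniformSphere n) → ∫ φ, F φ ∂uniformSphere n =
        C * ∫ t : ℝ × ℝ, (1 + (t.1 ^ 2 + t.2 ^ 2)) ^ (-(n : ℝ) / 2) *
          ∫ g, F (spin h n t g) ∂stdGaussian (EuclideanSpace ℝ (Fin n)) := by
  obtain ⟨C, hC0, hCt, hC⟩ := uniformSphere_eq_map h n hn hs
  refine ⟨C.toReal, ENNReal.toReal_ne_zero.2 ⟨hC0, hCt⟩, fun F hF hI => ?_⟩
  have hm := measurable_spin h n
  rw [hC, integrable_smul_measure hC0 hCt,
    integrable_map_measure hF.aestronglyMeasurable hm.aemeasurable] at hI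
  rw [hC, integral_smul_measure, integral_map hm.aemeasurable hF.aestronglyMeasurable,
    integral_prod (fun p => F (spin h n p.1 p.2)) hI, integral_withDensity_eq_integral_toReal_smul (by fun_prop) (by simp),
    smul_eq_mul]
  congr 1
  refine integral_congr_ae (Eventually.of_forall fun t => ?_)
  simp only [smul_eq_mul]
  rw [ENNReal.toReal_ofReal (by positivity)]

/-- Expectations in the Gibbs state as averages over gnomonic coordinates. -/
theorem integral_gibbsState (β J : ℝ) (h : ℕ → ℝ) (n : ℕ) [NeZero n] (hn : 3 ≤ n)
    (hs : 0 < fieldSD h n) (F : BoundedContinuousFunction (ℕ → ℝ) ℝ) :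
    ∫ x, F x ∂(gibbsState β J h n : Measure (ℕ → ℝ)) =
      (∫ t, Real.exp (n * tiltingFunction β J (fieldMean h n, fieldSD h n) (diskPoint t)) *
        ∫ g, F (zeroExtend n (spin h n t g)) ∂stdGaussian (EuclideanSpace ℝ (Fin n))) /
      ∫ t, Real.exp (n * tiltingFunction β J (fieldMean h n, fieldSD h n) (diskPoint t)) := by
  obtain ⟨C, hC0, hC⟩ := integral_uniformSphere h n hn hs
  have hz := measurable_zeroExtend n
  have hFm : Measurable F := F.continuous.measurable
  have hHm : Measurable (fun φ => Real.exp (-β * hamiltonian J h n φ)) := by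
    have := (continuous_hamiltonian J h n).measurable
    fun_prop
  have hI := integrable_exp_hamiltonian β J h n
  have hI2 : Integrable (fun φ => Real.exp (-β * hamiltonian J h n φ) * F (zeroExtend n φ))
      (uniformSphere n) :=
    hI.mul_bdd (c := ‖F‖) (hFm.comp hz).aestronglyMeasurable
      (Eventually.of_forall fun φ => F.norm_coe_le_norm _)
  change ∫ x, F x ∂((gibbsMeasure β J h n).map (zeroExtend n)) = _
  rw [integral_map hz.aemeasurable hFm.aestronglyMeasurable, gibbsMeasure, integral_tilted]
  simp only [smul_eq_mul, div_mul_eq_mul_div]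
  rw [integral_div, hC (fun φ => Real.exp (-β * hamiltonian J h n φ) * F (zeroExtend n φ))
    (hHm.mul (hFm.comp hz)) hI2, hC _ hHm hI, mul_div_mul_left _ _ hC0]
  -- The energy of `spin h n t g` does not involve `g`, so the exponential leaves the Gaussian
  -- integral.
  congr 1
  · refine integral_congr_ae (Eventually.of_forall fun t => ?_)
    simp only [exp_tiltingFunction_diskPoint,
      neg_mul_hamiltonian_spin β J h n hs, integral_const_mul, mul_assoc]
  · refine integral_congr_ae (Eventually.of_forall fun t => ?_)
    simp only [exp_tiltingFunction_diskPoint, neg_mul_hamiltonian_spin β J h n hs]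
    simp

/-- Realises the Gaussians of all dimensions on one probability space, so that almost sure limits in
`n` make sense. -/
theorem map_truncate_stdGaussianSeq (n : ℕ) :
    stdGaussianSeq.map (truncate n) = stdGaussian (EuclideanSpace ℝ (Fin n)) := by
  have hind : iIndepFun (fun (i : ℕ) (g : ℕ → ℝ) => g i) stdGaussianSeq :=
    iIndepFun_infinitePi (X := fun _ x => x) (by fun_prop)
  have hind' := hind.precomp (Fin.val_injective (n := n))
  have : IsProbabilityMeasure stdGaussianSeq := by unfold stdGaussianSeq; infer_instance
  rw [iIndepFun_iff_map_fun_eq_pi_map fun i => (measurable_pi_apply _).aemeasurable] at hind'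
  have he : ∀ i : ℕ, stdGaussianSeq.map (fun g : ℕ → ℝ => g i) = gaussianReal 0 1 := fun i =>
    Measure.infinitePi_map_eval _ i
  simp only [he] at hind'
  rw [← map_pi_eq_stdGaussian, ← hind', Measure.map_map (by fun_prop) (by fun_prop)]
  rfl

theorem measurable_truncate (n : ℕ) : Measurable (truncate n) := by
  unfold truncate; fun_prop

/-! ### Laplace's method -/

/-- Domination comes from `n Φ ≤ n ε + k Ψ + (n - k) a`: integrability at the single exponent `k`
controls all larger ones. -/
theorem integrable_exp_mul_of_le {X : Type*} [MeasurableSpace X] {μ : Measure X} {Ψ Φ : X → ℝ}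
    {a ε : ℝ} {k n : ℕ} (hk : Integrable (fun t => Real.exp (k * Ψ t)) μ) (ha : ∀ t, Ψ t ≤ a)
    (hΦ : Measurable Φ) (hle : ∀ t, |Φ t - Ψ t| ≤ ε) (hn : k ≤ n) :
    Integrable (fun t => Real.exp (n * Φ t)) μ := by
  refine (hk.const_mul (Real.exp (n * ε + (n - k) * a))).mono'
    (by fun_prop) (Eventually.of_forall fun t => ?_)
  rw [Real.norm_of_nonneg (Real.exp_pos _).le, ← Real.exp_add, Real.exp_le_exp]
  have h1 := (abs_le.1 (hle t)).2
  have h2 : (0 : ℝ) ≤ n - k := sub_nonneg.2 (by exact_mod_cast hn)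
  have h3 := mul_le_mul_of_nonneg_left (ha t) h2
  have h4 := mul_le_mul_of_nonneg_left h1 (Nat.cast_nonneg (α := ℝ) n)
  nlinarith

/-- Concentration of the weights `exp (n Ψₙ)` near the strict maximum of the limit `Ψ`. -/
theorem tendsto_setIntegral_exp_div {X : Type*} [TopologicalSpace X] [MeasurableSpace X]
    [OpensMeasurableSpace X] {μ : Measure X} [μ.IsOpenPosMeasure] {Ψ : X → ℝ} (hΨ : Continuous Ψ)
    {t₀ : X} (hle₀ : ∀ t, Ψ t ≤ Ψ t₀) {k : ℕ}
    (hk : Integrable (fun t => Real.exp (k * Ψ t)) μ) {Φ : ℕ → X → ℝ}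
    (hΦ : ∀ n, Measurable (Φ n)) {ε : ℕ → ℝ} (hε : Tendsto ε atTop (𝓝 0))
    (hle : ∀ n t, |Φ n t - Ψ t| ≤ ε n) {A : Set X} (hA : MeasurableSet A) {η : ℝ} (hη : 0 < η)
    (hAη : ∀ t ∈ A, Ψ t ≤ Ψ t₀ - η) :
    Tendsto (fun n : ℕ => (∫ t in A, Real.exp (n * Φ n t) ∂μ) / ∫ t, Real.exp (n * Φ n t) ∂μ)
      atTop (𝓝 0) := by
  -- A neighbourhood of the maximum losing less than `η/2`, used to bound the denominator from
  -- below; the set `A` loses at least `η`.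
  set V : Set X := {t | Ψ t₀ - η / 2 < Ψ t} with hV
  have hVo : IsOpen V := isOpen_lt continuous_const hΨ
  have hVne : V.Nonempty := ⟨t₀, by simp only [hV, Set.mem_ofPred_eq]; linarith⟩
  have hIV : 0 < ∫ t in V, Real.exp (k * Ψ t) ∂μ := by
    rw [setIntegral_pos_iff_support_of_nonneg_ae
      (Eventually.of_forall fun t => (Real.exp_pos _).le) hk.integrableOn]
    have : Function.support (fun t => Real.exp (k * Ψ t)) = Set.univ := by
      ext t; simp [(Real.exp_pos _).ne']
    rw [this, Set.univ_inter]
    exact hVo.measure_pos μ hVne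
  set I := ∫ t, Real.exp (k * Ψ t) ∂μ with hI
  set IV := ∫ t in V, Real.exp (k * Ψ t) ∂μ with hIVdef
  have hbound : ∀ᶠ n : ℕ in atTop,
      (∫ t in A, Real.exp (n * Φ n t) ∂μ) / ∫ t, Real.exp (n * Φ n t) ∂μ ≤
        Real.exp (k * η / 2) * (I / IV) * Real.exp (-(η / 4) * n) := by
    -- Numerator and denominator each cost `n ε n` against a margin `(n - k) η/2`. With `ε n < η/8`
    -- a decay rate `η/4` remains.
    filter_upwards [eventually_ge_atTop k, hε.eventually (gt_mem_nhds (show 0 < η / 8 by linarith))]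
      with n hn hεn
    have hnk : (0 : ℝ) ≤ n - k := sub_nonneg.2 (by exact_mod_cast hn)
    have hn0 : (0 : ℝ) ≤ n := Nat.cast_nonneg n
    have hint := integrable_exp_mul_of_le hk hle₀ (hΦ n) (hle n) hn
    have hnum : ∫ t in A, Real.exp (n * Φ n t) ∂μ ≤
        Real.exp (n * ε n + (n - k) * (Ψ t₀ - η)) * I := by
      rw [hI, ← integral_const_mul]
      refine le_trans (setIntegral_mono_on hint.integrableOn (hk.const_mul _).integrableOn hA
        fun t ht => ?_) (setIntegral_le_integral (hk.const_mul _)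
          (Eventually.of_forall fun t => by positivity))
      rw [← Real.exp_add, Real.exp_le_exp]
      have h1 := (abs_le.1 (hle n t)).2
      have h3 := mul_le_mul_of_nonneg_left (hAη t ht) hnk
      have h4 := mul_le_mul_of_nonneg_left h1 hn0
      nlinarith
    have hden : Real.exp (-(n * ε n) + (n - k) * (Ψ t₀ - η / 2)) * IV ≤
        ∫ t, Real.exp (n * Φ n t) ∂μ := by
      rw [hIVdef, ← integral_const_mul]
      refine le_trans (setIntegral_mono_on (hk.const_mul _).integrableOn hint.integrableOn
        hVo.measurableSet fun t ht => ?_) (setIntegral_le_integral hint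
          (Eventually.of_forall fun t => by positivity))
      rw [← Real.exp_add, Real.exp_le_exp]
      have h1 := (abs_le.1 (hle n t)).1
      have h3 := mul_le_mul_of_nonneg_left (le_of_lt ht) hnk
      have h4 := mul_le_mul_of_nonneg_left h1 hn0
      nlinarith
    have hI0 : 0 ≤ I := integral_nonneg fun t => (Real.exp_pos _).le
    calc _ ≤ (Real.exp (n * ε n + (n - k) * (Ψ t₀ - η)) * I) /
          (Real.exp (-(n * ε n) + (n - k) * (Ψ t₀ - η / 2)) * IV) :=
          div_le_div₀ (by positivity) hnum (by positivity) hden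
      _ = Real.exp (2 * (n * ε n) - (n - k) * (η / 2)) * (I / IV) := by
          rw [mul_div_mul_comm, ← Real.exp_sub]
          congr 2
          ring
      _ ≤ Real.exp (k * η / 2 + -(η / 4) * n) * (I / IV) := by
          refine mul_le_mul_of_nonneg_right (Real.exp_le_exp.2 ?_) (by positivity)
          nlinarith [mul_le_mul_of_nonneg_left hεn.le hn0]
      _ = _ := by rw [Real.exp_add]; ring
  refine squeeze_zero' (Eventually.of_forall fun n => ?_) hbound ?_
  · exact div_nonneg (integral_nonneg fun t => (Real.exp_pos _).le)
      (integral_nonneg fun t => (Real.exp_pos _).le)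
  · have : Tendsto (fun n : ℕ => Real.exp (-(η / 4) * n)) atTop (𝓝 0) :=
      Real.tendsto_exp_atBot.comp
        (tendsto_natCast_atTop_atTop.const_mul_atTop_of_neg (by linarith))
    simpa using this.const_mul (Real.exp (k * η / 2) * (I / IV))

/-- Laplace's method for functions converging jointly at the strict maximum. -/
theorem tendsto_integral_exp_mul_div {X : Type*} [TopologicalSpace X] [MeasurableSpace X]
    [OpensMeasurableSpace X] {μ : Measure X} [μ.IsOpenPosMeasure] {Ψ : X → ℝ} (hΨ : Continuous Ψ)
    {t₀ : X} (hle₀ : ∀ t, Ψ t ≤ Ψ t₀)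
    (hmax : ∀ U ∈ 𝓝 t₀, ∃ η > 0, ∀ t ∉ U, Ψ t ≤ Ψ t₀ - η) {k : ℕ}
    (hk : Integrable (fun t => Real.exp (k * Ψ t)) μ) {Φ : ℕ → X → ℝ}
    (hΦ : ∀ n, Measurable (Φ n)) {ε : ℕ → ℝ} (hε : Tendsto ε atTop (𝓝 0))
    (hle : ∀ n t, |Φ n t - Ψ t| ≤ ε n) {f : ℕ → X → ℝ} (hf : ∀ n, Measurable (f n)) {M : ℝ}
    (hM : ∀ n t, |f n t| ≤ M) {c : ℝ}
    (hc : Tendsto (fun p : ℕ × X => f p.1 p.2) (atTop ×ˢ 𝓝 t₀) (𝓝 c)) :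
    Tendsto (fun n : ℕ => (∫ t, Real.exp (n * Φ n t) * f n t ∂μ) /
      ∫ t, Real.exp (n * Φ n t) ∂μ) atTop (𝓝 c) := by
  have hX : (μ Set.univ) ≠ 0 := (isOpen_univ.measure_pos μ ⟨t₀, trivial⟩).ne'
  have hM0 : 0 ≤ M := (abs_nonneg _).trans (hM 0 t₀)
  rw [Metric.tendsto_atTop']
  intro δ hδ
  have hev := hc.eventually (Metric.ball_mem_nhds c (half_pos hδ))
  obtain ⟨p, hp, q, hq, hpq⟩ := eventually_prod_iff.1 hev
  obtain ⟨U, hUq, hUo, hU⟩ := mem_nhds_iff.1 hq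
  obtain ⟨η, hη, hUη⟩ := hmax U (hUo.mem_nhds hU)
  -- Inside `U` the integrand is within `δ/2` of `c`; outside it differs by at most `M + |c|`, on a
  -- set of vanishing relative weight.
  have hT := tendsto_setIntegral_exp_div hΨ hle₀ hk hΦ hε hle hUo.measurableSet.compl hη hUη
  have hT' := hT.const_mul (M + |c|)
  rw [mul_zero] at hT'
  obtain ⟨N, hN⟩ := eventually_atTop.1 ((hT'.eventually (gt_mem_nhds (half_pos hδ))).and
    (hp.and (eventually_ge_atTop k)))
  refine ⟨N, fun n hn => ?_⟩
  obtain ⟨h1, h2, h3⟩ := hN n hn.le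
  have hint := integrable_exp_mul_of_le hk hle₀ (hΦ n) (hle n) h3
  have hZ : 0 < ∫ t, Real.exp (n * Φ n t) ∂μ := by
    rw [integral_pos_iff_support_of_nonneg (fun t => (Real.exp_pos _).le) hint]
    have : Function.support (fun t => Real.exp (n * Φ n t)) = Set.univ := by
      ext t; simp [(Real.exp_pos _).ne']
    rw [this]
    exact pos_iff_ne_zero.2 hX
  have hfint : Integrable (fun t => Real.exp (n * Φ n t) * f n t) μ :=
    hint.mul_bdd (c := M) (hf n).aestronglyMeasurable (Eventually.of_forall (hM n))
  have hdint : Integrable (fun t => Real.exp (n * Φ n t) * |f n t - c|) μ :=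
    hint.mul_bdd (c := M + |c|) (((hf n).sub_const c).abs).aestronglyMeasurable
      (Eventually.of_forall fun t => by
        rw [Real.norm_eq_abs, abs_abs]
        exact (abs_sub _ _).trans (by gcongr; exact hM n t))
  have hdiff : (∫ t, Real.exp (n * Φ n t) * f n t ∂μ) / ∫ t, Real.exp (n * Φ n t) ∂μ - c =
      (∫ t, Real.exp (n * Φ n t) * (f n t - c) ∂μ) / ∫ t, Real.exp (n * Φ n t) ∂μ := by
    simp_rw [mul_sub]
    rw [integral_sub hfint (hint.mul_const c), integral_mul_const, sub_div,
      mul_div_assoc _ c, mul_comm _ (c / _), div_mul_cancel₀ _ hZ.ne']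
  rw [Real.dist_eq, hdiff, abs_div, abs_of_pos hZ, div_lt_iff₀ hZ]
  rw [← mul_div_assoc, div_lt_iff₀ hZ] at h1
  calc _ ≤ ∫ t, Real.exp (n * Φ n t) * |f n t - c| ∂μ := by
        refine (abs_integral_le_integral_abs).trans (le_of_eq ?_)
        simp_rw [abs_mul, abs_of_pos (Real.exp_pos _)]
    _ = (∫ t in U, Real.exp (n * Φ n t) * |f n t - c| ∂μ) +
        ∫ t in Uᶜ, Real.exp (n * Φ n t) * |f n t - c| ∂μ :=
        (integral_add_compl hUo.measurableSet hdint).symm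
    _ ≤ (∫ t in U, Real.exp (n * Φ n t) * (δ / 2) ∂μ) +
        ∫ t in Uᶜ, Real.exp (n * Φ n t) * (M + |c|) ∂μ := by
        refine add_le_add (setIntegral_mono_on hdint.integrableOn (hint.mul_const _).integrableOn
          hUo.measurableSet fun t ht => ?_) (setIntegral_mono_on hdint.integrableOn
          (hint.mul_const _).integrableOn hUo.measurableSet.compl fun t ht => ?_)
        · have := hpq h2 (hUq ht)
          rw [Real.dist_eq] at this
          exact mul_le_mul_of_nonneg_left this.le (Real.exp_pos _).le
        · gcongr
          exact (abs_sub _ _).trans (by gcongr; exact hM n t)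
    _ ≤ (∫ t, Real.exp (n * Φ n t) ∂μ) * (δ / 2) +
        (M + |c|) * ∫ t in Uᶜ, Real.exp (n * Φ n t) ∂μ := by
        rw [integral_mul_const, integral_mul_const, mul_comm (M + |c|)]
        exact add_le_add (mul_le_mul_of_nonneg_right (setIntegral_le_integral hint
          (Eventually.of_forall fun t => (Real.exp_pos _).le)) (half_pos hδ).le) le_rfl
    _ < δ * ∫ t, Real.exp (n * Φ n t) ∂μ := by linarith

/-! ### The tilting function in gnomonic coordinates -/

/-- Gnomonic coordinates of a point of the open unit disk. -/
noncomputable def gnomonic (z : ℝ × ℝ) : ℝ × ℝ :=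
  ((Real.sqrt (1 - (z.1 ^ 2 + z.2 ^ 2)))⁻¹ * z.1, (Real.sqrt (1 - (z.1 ^ 2 + z.2 ^ 2)))⁻¹ * z.2)

theorem diskPoint_mem_unitDisk (t : ℝ × ℝ) : diskPoint t ∈ unitDisk := by
  have h := norm_diskPoint_sq t
  have hp : 0 < (1 + (t.1 ^ 2 + t.2 ^ 2))⁻¹ := by positivity
  simp only [unitDisk, Set.mem_ofPred_eq]
  linarith

theorem gnomonic_diskPoint (t : ℝ × ℝ) : gnomonic (diskPoint t) = t := by
  have hp : 0 < Real.sqrt (1 + (t.1 ^ 2 + t.2 ^ 2)) := Real.sqrt_pos.2 (by positivity)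
  rw [gnomonic, norm_diskPoint_sq, Real.sqrt_inv, inv_inv, diskPoint]
  ext
  · exact mul_inv_cancel_left₀ hp.ne' _
  · exact mul_inv_cancel_left₀ hp.ne' _

theorem one_add_gnomonic_sq {z : ℝ × ℝ} (hz : z ∈ unitDisk) :
    1 + ((gnomonic z).1 ^ 2 + (gnomonic z).2 ^ 2) = (1 - (z.1 ^ 2 + z.2 ^ 2))⁻¹ := by
  have hp : 0 < 1 - (z.1 ^ 2 + z.2 ^ 2) := sub_pos.2 hz
  simp only [gnomonic, mul_pow, inv_pow, Real.sq_sqrt hp.le]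
  field_simp
  ring

theorem diskPoint_gnomonic {z : ℝ × ℝ} (hz : z ∈ unitDisk) : diskPoint (gnomonic z) = z := by
  have hp : 0 < Real.sqrt (1 - (z.1 ^ 2 + z.2 ^ 2)) := Real.sqrt_pos.2 (sub_pos.2 hz)
  rw [diskPoint, one_add_gnomonic_sq hz, Real.sqrt_inv, inv_inv, gnomonic]
  ext
  · exact mul_inv_cancel_left₀ hp.ne' _
  · exact mul_inv_cancel_left₀ hp.ne' _

theorem continuous_diskPoint : Continuous diskPoint := by
  have h : ∀ t : ℝ × ℝ, Real.sqrt (1 + (t.1 ^ 2 + t.2 ^ 2)) ≠ 0 := fun t =>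
    (Real.sqrt_pos.2 (by positivity)).ne'
  unfold diskPoint
  fun_prop (disch := exact h _)

theorem abs_diskPoint_le (t : ℝ × ℝ) : |(diskPoint t).1| ≤ 1 ∧ |(diskPoint t).2| ≤ 1 := by
  have h : (diskPoint t).1 ^ 2 + (diskPoint t).2 ^ 2 < 1 := diskPoint_mem_unitDisk t
  constructor <;> rw [← sq_le_one_iff_abs_le_one] <;> nlinarith [sq_nonneg (diskPoint t).1,
    sq_nonneg (diskPoint t).2]

theorem continuous_tiltingFunction_diskPoint (β J : ℝ) (m : ℝ × ℝ) :
    Continuous fun t => tiltingFunction β J m (diskPoint t) := by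
  have hd := continuous_diskPoint
  have h : ∀ t : ℝ × ℝ, 1 - ((diskPoint t).1 ^ 2 + (diskPoint t).2 ^ 2) ≠ 0 := fun t => by
    rw [norm_diskPoint_sq]; positivity
  have h1 : Continuous fun t => (diskPoint t).1 := hd.fst
  have h2 : Continuous fun t => (diskPoint t).2 := hd.snd
  have hl := Continuous.log (continuous_const.sub ((h1.pow 2).add (h2.pow 2))) h
  unfold tiltingFunction
  exact ((h1.pow 2).const_mul _).add (((h1.const_mul _).add (h2.const_mul _)).const_mul _)
    |>.add (hl.const_mul _)

/-- The parameters enter linearly, paired with disk coordinates bounded by one, so the bound is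
uniform over the noncompact plane. -/
theorem abs_tiltingFunction_sub_le {β : ℝ} (hβ : 0 < β) (J : ℝ) (m m' t : ℝ × ℝ) :
    |tiltingFunction β J m' (diskPoint t) - tiltingFunction β J m (diskPoint t)| ≤
      β * (|m'.1 - m.1| + |m'.2 - m.2|) := by
  obtain ⟨h1, h2⟩ := abs_diskPoint_le t
  have : tiltingFunction β J m' (diskPoint t) - tiltingFunction β J m (diskPoint t) =
      β * ((m'.1 - m.1) * (diskPoint t).1 + (m'.2 - m.2) * (diskPoint t).2) := by
    unfold tiltingFunction; ring
  rw [this, abs_mul, abs_of_pos hβ]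
  refine mul_le_mul_of_nonneg_left ((abs_add_le _ _).trans (add_le_add ?_ ?_)) hβ.le
  · rw [abs_mul]; exact mul_le_of_le_one_right (abs_nonneg _) h1
  · rw [abs_mul]; exact mul_le_of_le_one_right (abs_nonneg _) h2

theorem norm_sq_le_add_sq (t : ℝ × ℝ) : ‖t‖ ^ 2 ≤ t.1 ^ 2 + t.2 ^ 2 := by
  rw [Prod.norm_def]
  rcases max_choice ‖t.1‖ ‖t.2‖ with h | h <;> rw [h, Real.norm_eq_abs, sq_abs] <;>
    nlinarith [sq_nonneg t.1, sq_nonneg t.2]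

/-- On the disk every term except the logarithm is bounded, which gives coercivity in `t`. The norm
here is the supremum norm, dominated by the Euclidean one. -/
theorem tiltingFunction_diskPoint_le {β J : ℝ} (hβ : 0 < β) (hJ : 0 < J) (m t : ℝ × ℝ) :
    tiltingFunction β J m (diskPoint t) ≤
      β * J / 2 + β * (|m.1| + |m.2|) - 1 / 2 * Real.log (1 + ‖t‖ ^ 2) := by
  obtain ⟨h1, h2⟩ := abs_diskPoint_le t
  rw [tiltingFunction, norm_diskPoint_sq, Real.log_inv]
  have hl : Real.log (1 + ‖t‖ ^ 2) ≤ Real.log (1 + (t.1 ^ 2 + t.2 ^ 2)) :=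
    Real.log_le_log (by positivity) (by linarith [norm_sq_le_add_sq t])
  have hx : (diskPoint t).1 ^ 2 ≤ 1 := (sq_le_one_iff_abs_le_one _).2 h1
  have hm1 : m.1 * (diskPoint t).1 ≤ |m.1| :=
    (le_abs_self _).trans (by rw [abs_mul]; exact mul_le_of_le_one_right (abs_nonneg _) h1)
  have hm2 : m.2 * (diskPoint t).2 ≤ |m.2| :=
    (le_abs_self _).trans (by rw [abs_mul]; exact mul_le_of_le_one_right (abs_nonneg _) h2)
  have e1 : β * J / 2 * (diskPoint t).1 ^ 2 ≤ β * J / 2 := mul_le_of_le_one_right (by positivity) hx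
  have e2 := mul_le_mul_of_nonneg_left (add_le_add hm1 hm2) hβ.le
  linarith

/-- The exponent 3 gives decay `(1 + ‖t‖²) ^ (-3/2)`, integrable over the plane because 3 exceeds
the dimension 2. -/
theorem integrable_exp_tiltingFunction {β J : ℝ} (hβ : 0 < β) (hJ : 0 < J) (m : ℝ × ℝ) :
    Integrable fun t : ℝ × ℝ =>
      Real.exp ((3 : ℕ) * tiltingFunction β J m (diskPoint t)) := by
  have hc := continuous_tiltingFunction_diskPoint β J m
  have hI := integrable_rpow_neg_one_add_norm_sq (E := ℝ × ℝ) (μ := volume) (r := 3)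
    (by norm_num)
  refine (hI.const_mul (Real.exp (3 * (β * J / 2 + β * (|m.1| + |m.2|))))).mono'
    (Real.continuous_exp.comp (hc.const_mul _)).aestronglyMeasurable (Eventually.of_forall fun t => ?_)
  rw [Real.norm_of_nonneg (Real.exp_pos _).le, Real.rpow_def_of_pos (by positivity),
    ← Real.exp_add, Real.exp_le_exp]
  have := tiltingFunction_diskPoint_le hβ hJ m t
  push_cast
  linarith

theorem tiltingFunction_diskPoint_le_gnomonic {β J : ℝ} {m z : ℝ × ℝ}
    (hz : maximizers β J m = {z}) (t : ℝ × ℝ) :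
    tiltingFunction β J m (diskPoint t) ≤ tiltingFunction β J m (diskPoint (gnomonic z)) := by
  have h : z ∈ maximizers β J m := by simp [hz]
  rw [diskPoint_gnomonic h.1]
  exact h.2 _ (diskPoint_mem_unitDisk t)

theorem tiltingFunction_diskPoint_lt_gnomonic {β J : ℝ} {m z : ℝ × ℝ}
    (hz : maximizers β J m = {z}) {t : ℝ × ℝ} (ht : t ≠ gnomonic z) :
    tiltingFunction β J m (diskPoint t) < tiltingFunction β J m (diskPoint (gnomonic z)) := by
  refine lt_of_le_of_ne (tiltingFunction_diskPoint_le_gnomonic hz t) fun heq => ht ?_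
  have h : z ∈ maximizers β J m := by simp [hz]
  have : diskPoint t ∈ maximizers β J m := by
    refine ⟨diskPoint_mem_unitDisk t, fun w hw => ?_⟩
    rw [heq, diskPoint_gnomonic h.1]
    exact h.2 w hw
  rw [hz, Set.mem_singleton_iff] at this
  rw [← this, gnomonic_diskPoint]

/-- The unique maximiser is well separated. -/
theorem exists_tiltingFunction_gap {β J : ℝ} (hβ : 0 < β) (hJ : 0 < J) {m z : ℝ × ℝ}
    (hz : maximizers β J m = {z}) {U : Set (ℝ × ℝ)} (hU : U ∈ 𝓝 (gnomonic z)) :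
    ∃ η > 0, ∀ t ∉ U, tiltingFunction β J m (diskPoint t) ≤
      tiltingFunction β J m (diskPoint (gnomonic z)) - η := by
  set a := tiltingFunction β J m (diskPoint (gnomonic z)) with ha
  set B := β * J / 2 + β * (|m.1| + |m.2|) with hB
  -- Chosen so that `B - ½ log (1 + R²) ≤ a - 1`: beyond radius `R` the gap is at least 1. Inside,
  -- compactness and uniqueness of the maximiser give the gap.
  set R := Real.sqrt (Real.exp (2 * (B - a + 1))) with hR
  have hfar : ∀ t : ℝ × ℝ, R < ‖t‖ → tiltingFunction β J m (diskPoint t) ≤ a - 1 := by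
    intro t ht
    have h1 := tiltingFunction_diskPoint_le hβ hJ m t
    have h2 : Real.exp (2 * (B - a + 1)) ≤ 1 + ‖t‖ ^ 2 := by
      have := (Real.sqrt_lt' ((Real.sqrt_nonneg _).trans_lt ht)).1 ht
      linarith
    have h3 := (Real.le_log_iff_exp_le (by positivity)).2 h2
    linarith
  have hK : IsCompact (Metric.closedBall (0 : ℝ × ℝ) R ∩ (interior U)ᶜ) :=
    (isCompact_closedBall _ _).inter_right isOpen_interior.isClosed_compl
  have hnot : ∀ t ∉ U, ‖t‖ ≤ R → t ∈ Metric.closedBall (0 : ℝ × ℝ) R ∩ (interior U)ᶜ :=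
    fun t ht htR => ⟨by simpa using htR, fun h => ht (interior_subset h)⟩
  rcases Set.eq_empty_or_nonempty (Metric.closedBall (0 : ℝ × ℝ) R ∩ (interior U)ᶜ) with he | hne
  · refine ⟨1, one_pos, fun t ht => ?_⟩
    rcases le_or_gt ‖t‖ R with h | h
    · exact absurd (hnot t ht h) (by simp [he])
    · exact hfar t h
  · obtain ⟨s, hs, hmax⟩ := hK.exists_isMaxOn hne
      (continuous_tiltingFunction_diskPoint β J m).continuousOn
    have hslt := tiltingFunction_diskPoint_lt_gnomonic hz (t := s) (by
      rintro rfl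
      exact hs.2 (mem_interior_iff_mem_nhds.2 hU))
    refine ⟨min 1 (a - tiltingFunction β J m (diskPoint s)),
      lt_min one_pos (sub_pos.2 hslt), fun t ht => ?_⟩
    rcases le_or_gt ‖t‖ R with h | h
    · have h1 : tiltingFunction β J m (diskPoint t) ≤ tiltingFunction β J m (diskPoint s) :=
        hmax (hnot t ht h)
      linarith [min_le_right 1 (a - tiltingFunction β J m (diskPoint s))]
    · linarith [hfar t h, min_le_left 1 (a - tiltingFunction β J m (diskPoint s))]

/-! ### Almost sure limits for the Gaussian sequence -/

instance isProbabilityMeasure_stdGaussianSeq : IsProbabilityMeasure stdGaussianSeq := by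
  unfold stdGaussianSeq; infer_instance

/-- The variable `⟨v, g⟩` is a centred Gaussian of variance `‖v‖²`, that is, `‖v‖` times a standard
one. -/
theorem lintegral_inner_pow_four_stdGaussian {E : Type*} [NormedAddCommGroup E]
    [InnerProductSpace ℝ E] [FiniteDimensional ℝ E] [MeasurableSpace E] [BorelSpace E] (v : E) :
    ∫⁻ g, ENNReal.ofReal (inner ℝ v g ^ 4) ∂stdGaussian E =
      ENNReal.ofReal (‖v‖ ^ 4) * ∫⁻ x, ENNReal.ofReal (x ^ 4) ∂gaussianReal 0 1 := by
  have hL := IsGaussian.map_eq_gaussianReal (μ := stdGaussian E) (innerSL ℝ v)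
  rw [integral_strongDual_stdGaussian, variance_dual_stdGaussian, innerSL_apply_norm] at hL
  have hv : gaussianReal 0 (‖v‖ ^ 2).toNNReal = (gaussianReal 0 1).map (‖v‖ * ·) := by
    rw [gaussianReal_map_const_mul, mul_zero, mul_one]
    congr 1
    exact NNReal.eq (by simp)
  have h1 : ∫⁻ g, ENNReal.ofReal (inner ℝ v g ^ 4) ∂stdGaussian E =
      ∫⁻ x, ENNReal.ofReal (x ^ 4) ∂((stdGaussian E).map (innerSL ℝ v)) := by
    rw [lintegral_map (by fun_prop) (by fun_prop)]
    rfl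
  rw [h1, hL, hv, lintegral_map (by fun_prop) (by fun_prop), ← lintegral_const_mul _ (by fun_prop)]
  refine lintegral_congr fun x => ?_
  rw [mul_pow, ENNReal.ofReal_mul (by positivity)]

theorem lintegral_pow_four_gaussianReal_ne_top :
    ∫⁻ x, ENNReal.ofReal (x ^ 4) ∂gaussianReal 0 1 ≠ ⊤ := by
  have h := (memLp_id_gaussianReal (μ := 0) (v := 1) 4).integrable_norm_pow (by simp)
  have := h.2
  rw [hasFiniteIntegral_iff_ofReal (Eventually.of_forall fun x => by positivity)] at this
  refine ne_of_eq_of_ne (lintegral_congr fun x => ?_) this.ne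
  congr 1
  simp [Even.pow_abs (show Even 4 by decide)]

/-- The vectors vary arbitrarily with `n`, so moments are used instead of a law of large numbers.
Fourth moments are `O(n⁻²)`, hence summable, and the series of fourth powers is almost surely
finite; second moments would give only `O(n⁻¹)`. -/
theorem ae_tendsto_inner_truncate_div_sqrt (v : ∀ n, EuclideanSpace ℝ (Fin n))
    (hv : ∀ n, ‖v n‖ ≤ 1) :
    ∀ᵐ g ∂stdGaussianSeq,
      Tendsto (fun n : ℕ => inner ℝ (v n) (truncate n g) / Real.sqrt n) atTop (𝓝 0) := by
  set M := ∫⁻ x, ENNReal.ofReal (x ^ 4) ∂gaussianReal 0 1 with hM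
  have hmeas : ∀ n : ℕ, Measurable fun g : ℕ → ℝ =>
      ENNReal.ofReal ((inner ℝ (v n) (truncate n g) / Real.sqrt n) ^ 4) := fun n => by
    have := measurable_truncate n
    fun_prop
  have hle : ∀ n : ℕ, ∫⁻ g, ENNReal.ofReal ((inner ℝ (v n) (truncate n g) / Real.sqrt n) ^ 4)
      ∂stdGaussianSeq ≤ ENNReal.ofReal (1 / (n : ℝ) ^ 2) * M := by
    intro n
    have h4 : Real.sqrt n ^ 4 = (n : ℝ) ^ 2 := by
      rw [show 4 = 2 * 2 from rfl, pow_mul, Real.sq_sqrt (Nat.cast_nonneg n)]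
    have : ∀ g : ℕ → ℝ, ENNReal.ofReal ((inner ℝ (v n) (truncate n g) / Real.sqrt n) ^ 4) =
        ENNReal.ofReal (1 / (n : ℝ) ^ 2) *
          ENNReal.ofReal (inner ℝ (v n) (truncate n g) ^ 4) := fun g => by
      rw [← ENNReal.ofReal_mul (by positivity), div_pow, h4]
      congr 1
      ring
    simp_rw [this]
    have hmap := lintegral_map (μ := stdGaussianSeq)
      (f := fun g => ENNReal.ofReal (inner ℝ (v n) g ^ 4)) (by fun_prop) (measurable_truncate n)
    rw [lintegral_const_mul _ (by have := measurable_truncate n; fun_prop), ← hmap,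
      map_truncate_stdGaussianSeq, lintegral_inner_pow_four_stdGaussian]
    gcongr
    calc ENNReal.ofReal (‖v n‖ ^ 4) * M ≤ 1 * M := by
          gcongr
          rw [ENNReal.ofReal_le_one]
          exact pow_le_one₀ (norm_nonneg _) (hv n)
      _ = M := one_mul _
  have hsum : ∫⁻ g, ∑' n : ℕ, ENNReal.ofReal ((inner ℝ (v n) (truncate n g) / Real.sqrt n) ^ 4)
      ∂stdGaussianSeq ≠ ⊤ := by
    rw [lintegral_tsum fun n => (hmeas n).aemeasurable]
    refine ne_top_of_le_ne_top ?_ (ENNReal.tsum_le_tsum hle)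
    rw [ENNReal.tsum_mul_right]
    exact ENNReal.mul_ne_top (Real.summable_one_div_nat_pow.2 one_lt_two).tsum_ofReal_ne_top
      lintegral_pow_four_gaussianReal_ne_top
  filter_upwards [ae_lt_top (Measurable.tsum hmeas) hsum] with g hg
  have h0 := ENNReal.tendsto_atTop_zero_of_tsum_ne_top hg.ne
  have h1 := (ENNReal.tendsto_toReal ENNReal.zero_ne_top).comp h0
  have h2 : Tendsto (fun n : ℕ => (inner ℝ (v n) (truncate n g) / Real.sqrt n) ^ 4) atTop (𝓝 0) := by
    refine (h1.congr fun n => ?_)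
    simp only [Function.comp_apply]
    rw [ENNReal.toReal_ofReal (by positivity)]
  -- Two square roots turn the fourth power into an absolute value.
  have h3 := (h2.sqrt).sqrt
  rw [Real.sqrt_zero, Real.sqrt_zero] at h3
  rw [tendsto_zero_iff_abs_tendsto_zero]
  refine h3.congr fun n => ?_
  rw [show 4 = 2 * 2 from rfl, pow_mul, Real.sqrt_sq (by positivity), Real.sqrt_sq_eq_abs]
  rfl

theorem ae_tendsto_sum_sq_div :
    ∀ᵐ g ∂stdGaussianSeq,
      Tendsto (fun n : ℕ => (∑ i ∈ Finset.range n, g i ^ 2) / (n : ℝ)) atTop (𝓝 1) := by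
  have hind : iIndepFun (fun (i : ℕ) (g : ℕ → ℝ) => g i) stdGaussianSeq :=
    iIndepFun_infinitePi (X := fun _ x => x) (by fun_prop)
  have hmap : ∀ i : ℕ, stdGaussianSeq.map (fun g : ℕ → ℝ => g i) = gaussianReal 0 1 := fun i =>
    Measure.infinitePi_map_eval _ i
  have hid : ∀ i : ℕ, IdentDistrib (fun g : ℕ → ℝ => g i) (fun g : ℕ → ℝ => g 0)
      stdGaussianSeq stdGaussianSeq := fun i =>
    ⟨(measurable_pi_apply i).aemeasurable, (measurable_pi_apply 0).aemeasurable, by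
      rw [hmap, hmap]⟩
  have hint : Integrable (fun x : ℝ => x ^ 2) (gaussianReal 0 1) :=
    (memLp_id_gaussianReal (μ := 0) (v := 1) 2).integrable_sq
  have hE : ∫ g, g 0 ^ 2 ∂stdGaussianSeq = 1 := by
    have h1 := integral_map (μ := stdGaussianSeq) (φ := fun g : ℕ → ℝ => g 0)
      (measurable_pi_apply 0).aemeasurable
      (f := fun x => x ^ 2) (by fun_prop)
    rw [← h1, hmap]
    have h2 := variance_fun_id_gaussianReal (μ := 0) (v := 1)
    rw [variance_eq_integral (by fun_prop)] at h2
    simpa using h2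
  have hint0 : Integrable (fun g : ℕ → ℝ => g 0 ^ 2) stdGaussianSeq := by
    rw [← hmap 0] at hint
    exact hint.comp_measurable (measurable_pi_apply 0)
  have := strong_law_ae_real (μ := stdGaussianSeq) (fun i g => g i ^ 2) hint0
    (fun i j hij => (hind.indepFun hij).comp (φ := fun x => x ^ 2) (ψ := fun x => x ^ 2)
      (by fun_prop) (by fun_prop))
    (fun i => (hid i).comp (u := fun x => x ^ 2) (by fun_prop))
  rwa [hE] at this

/-! ### Convergence of the Gibbs states -/

theorem norm_onesDir_le (n : ℕ) : ‖onesDir n‖ ≤ 1 := by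
  rcases Nat.eq_zero_or_pos n with rfl | hn
  · simp [EuclideanSpace.norm_eq]
  · have : NeZero n := ⟨hn.ne'⟩
    exact (norm_onesDir n).le

/-- If the empirical deviation vanishes, division by zero makes the vector zero, so the bound holds
for every `n`, as the almost sure limit along all `n` requires. -/
theorem norm_fieldDir_le (h : ℕ → ℝ) (n : ℕ) : ‖fieldDir h n‖ ≤ 1 := by
  rcases (show 0 ≤ fieldSD h n from Real.sqrt_nonneg _).eq_or_lt with hs | hs
  · simp [EuclideanSpace.norm_eq, fieldDir, ← hs]
  · rcases Nat.eq_zero_or_pos n with rfl | hn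
    · simp [EuclideanSpace.norm_eq]
    · have : NeZero n := ⟨hn.ne'⟩
      exact (norm_fieldDir h n hs).le

/-- The factors `√n` are distributed so that each `n`-dependent quantity on the right has an almost
sure limit. -/
theorem zeroExtend_spin_apply (h g : ℕ → ℝ) (t : ℝ × ℝ) {n i : ℕ} (hi : i < n)
    (hs : 0 < fieldSD h n) :
    zeroExtend n (spin h n t (truncate n g)) i =
      (diskPoint t).1 + (diskPoint t).2 * ((h i - fieldMean h n) / fieldSD h n) +
        (Real.sqrt (1 + (t.1 ^ 2 + t.2 ^ 2)))⁻¹ *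
          ((Real.sqrt ((∑ i ∈ Finset.range n, g i ^ 2) / n -
            (inner ℝ (onesDir n) (truncate n g) / Real.sqrt n) ^ 2 -
            (inner ℝ (fieldDir h n) (truncate n g) / Real.sqrt n) ^ 2))⁻¹ *
          (g i - inner ℝ (onesDir n) (truncate n g) / Real.sqrt n -
            inner ℝ (fieldDir h n) (truncate n g) / Real.sqrt n *
              ((h i - fieldMean h n) / fieldSD h n))) := by
  have : NeZero n := ⟨by omega⟩
  have hn : (0 : ℝ) < n := by exact_mod_cast NeZero.pos n
  have hr : 0 < Real.sqrt n := Real.sqrt_pos.2 hn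
  have hnorm : Real.sqrt ((∑ i ∈ Finset.range n, g i ^ 2) / n -
      (inner ℝ (onesDir n) (truncate n g) / Real.sqrt n) ^ 2 -
      (inner ℝ (fieldDir h n) (truncate n g) / Real.sqrt n) ^ 2) =
      ‖perp (onesDir n) (fieldDir h n) (truncate n g)‖ / Real.sqrt n := by
    have hg : ‖truncate n g‖ ^ 2 = ∑ i ∈ Finset.range n, g i ^ 2 := by
      rw [EuclideanSpace.norm_sq_eq, ← Fin.sum_univ_eq_sum_range (fun i => g i ^ 2)]
      simp [truncate]
    rw [← Real.sqrt_sq (norm_nonneg (perp _ _ _)), norm_perp_sq (norm_onesDir n)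
      (norm_fieldDir h n hs) (inner_onesDir_fieldDir h n), ← Real.sqrt_div' _ hn.le, hg, div_pow,
      div_pow, Real.sq_sqrt hn.le, sub_div, sub_div]
  rw [hnorm, zeroExtend, dif_pos hi]
  simp only [spin, spherePoint, PiLp.smul_apply, PiLp.add_apply, smul_eq_mul]
  have hp : perp (onesDir n) (fieldDir h n) (truncate n g) ⟨i, hi⟩ =
      g i - inner ℝ (onesDir n) (truncate n g) / Real.sqrt n -
            inner ℝ (fieldDir h n) (truncate n g) / Real.sqrt n *
              ((h i - fieldMean h n) / fieldSD h n) := by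
    conv_lhs => rw [perp]
    simp only [PiLp.sub_apply, PiLp.smul_apply, smul_eq_mul, truncate, onesDir, fieldDir]
    ring
  rw [hp]
  simp only [onesDir, fieldDir, diskPoint, inv_div]
  field_simp

/-- In the product topology it suffices to treat one coordinate, where the explicit formula holds
once `n > i` and the deviation is positive. The limit is joint in `n` and `t`, as Laplace's method
needs. -/
theorem tendsto_zeroExtend_spin {h g : ℕ → ℝ} {m z : ℝ × ℝ}
    (hm1 : Tendsto (fieldMean h) atTop (𝓝 m.1)) (hm2 : Tendsto (fieldSD h) atTop (𝓝 m.2))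
    (hm : 0 < m.2) (hz : z ∈ unitDisk)
    (ha : Tendsto (fun n : ℕ => inner ℝ (onesDir n) (truncate n g) / Real.sqrt n) atTop (𝓝 0))
    (hb : Tendsto (fun n : ℕ => inner ℝ (fieldDir h n) (truncate n g) / Real.sqrt n) atTop (𝓝 0))
    (hg : Tendsto (fun n : ℕ => (∑ i ∈ Finset.range n, g i ^ 2) / (n : ℝ)) atTop (𝓝 1)) :
    Tendsto (fun p : ℕ × (ℝ × ℝ) => zeroExtend p.1 (spin h p.1 p.2 (truncate p.1 g)))
      (atTop ×ˢ 𝓝 (gnomonic z)) (𝓝 (transportMap m z h g)) := by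
  rw [tendsto_pi_nhds]
  intro i
  have hq : Tendsto (fun n : ℕ => (h i - fieldMean h n) / fieldSD h n) atTop
      (𝓝 ((h i - m.1) / m.2)) := (tendsto_const_nhds.sub hm1).div hm2 hm.ne'
  have hn : Tendsto (fun n : ℕ => (Real.sqrt ((∑ i ∈ Finset.range n, g i ^ 2) / n -
            (inner ℝ (onesDir n) (truncate n g) / Real.sqrt n) ^ 2 -
            (inner ℝ (fieldDir h n) (truncate n g) / Real.sqrt n) ^ 2))⁻¹) atTop (𝓝 1) := by
    have := (((hg.sub (ha.pow 2)).sub (hb.pow 2)).sqrt).inv₀ (by norm_num)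
    simpa using this
  have hu := hn.mul (((tendsto_const_nhds (x := g i)).sub ha).sub (hb.mul hq))
  have hd : Tendsto diskPoint (𝓝 (gnomonic z)) (𝓝 z) := by
    have := continuous_diskPoint.tendsto (gnomonic z)
    rwa [diskPoint_gnomonic hz] at this
  have hd1 : Tendsto (fun t => (diskPoint t).1) (𝓝 (gnomonic z)) (𝓝 z.1) :=
    (continuous_fst.tendsto z).comp hd
  have hd2 : Tendsto (fun t => (diskPoint t).2) (𝓝 (gnomonic z)) (𝓝 z.2) :=
    (continuous_snd.tendsto z).comp hd
  have hs : Tendsto (fun t : ℝ × ℝ => (Real.sqrt (1 + (t.1 ^ 2 + t.2 ^ 2)))⁻¹) (𝓝 (gnomonic z))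
      (𝓝 (Real.sqrt (1 - (z.1 ^ 2 + z.2 ^ 2)))) := by
    have hc : Continuous fun t : ℝ × ℝ => (Real.sqrt (1 + (t.1 ^ 2 + t.2 ^ 2)))⁻¹ :=
      Continuous.inv₀ (by fun_prop) fun t => (Real.sqrt_pos.2 (by positivity)).ne'
    have := hc.tendsto (gnomonic z)
    rwa [one_add_gnomonic_sq hz, Real.sqrt_inv, inv_inv] at this
  have h1 : Tendsto Prod.fst ((atTop : Filter ℕ) ×ˢ 𝓝 (gnomonic z)) atTop := tendsto_fst
  have h2 : Tendsto Prod.snd ((atTop : Filter ℕ) ×ˢ 𝓝 (gnomonic z)) (𝓝 (gnomonic z)) :=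
    tendsto_snd
  have hfin := ((hd1.comp h2).add ((hd2.comp h2).mul (hq.comp h1))).add
    ((hs.comp h2).mul (hu.comp h1))
  have hlim : transportMap m z h g i = z.1 + z.2 * ((h i - m.1) / m.2) +
      Real.sqrt (1 - (z.1 ^ 2 + z.2 ^ 2)) * (1 * (g i - 0 - 0 * ((h i - m.1) / m.2))) := by
    rw [transportMap]; ring
  rw [hlim]
  refine hfin.congr' ?_
  have hev : ∀ᶠ p : ℕ × (ℝ × ℝ) in atTop ×ˢ 𝓝 (gnomonic z), i < p.1 ∧ 0 < fieldSD h p.1 :=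
    ((eventually_gt_atTop i).and (hm2.eventually (lt_mem_nhds hm))).prod_inl _
  filter_upwards [hev] with p hp
  rw [zeroExtend_spin_apply h g p.2 hp.1 hp.2]
  rfl

/-- Average of `F` over the Gaussian directions of a spin with gnomonic coordinates `t`. -/
noncomputable def spinAverage (h : ℕ → ℝ) (F : BoundedContinuousFunction (ℕ → ℝ) ℝ) (n : ℕ)
    (t : ℝ × ℝ) : ℝ :=
  ∫ g, F (zeroExtend n (spin h n t (truncate n g))) ∂stdGaussianSeq

theorem measurable_spin_truncate (h : ℕ → ℝ) (n : ℕ) :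
    Measurable fun p : (ℝ × ℝ) × (ℕ → ℝ) => spin h n p.1 (truncate n p.2) := by
  have := measurable_truncate n
  unfold spin spherePoint perp
  fun_prop

theorem measurable_comp_spin_truncate (h : ℕ → ℝ) (F : BoundedContinuousFunction (ℕ → ℝ) ℝ)
    (n : ℕ) : Measurable fun p : (ℝ × ℝ) × (ℕ → ℝ) =>
      F (zeroExtend n (spin h n p.1 (truncate n p.2))) := by
  have h1 := measurable_spin_truncate h n
  have h2 := measurable_zeroExtend n
  have h3 := F.continuous.measurable
  exact (h3.comp h2).comp h1

theorem measurable_spinAverage (h : ℕ → ℝ) (F : BoundedContinuousFunction (ℕ → ℝ) ℝ) (n : ℕ) :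
    Measurable (spinAverage h F n) :=
  ((measurable_comp_spin_truncate h F n).stronglyMeasurable.integral_prod_right').measurable

theorem abs_spinAverage_le (h : ℕ → ℝ) (F : BoundedContinuousFunction (ℕ → ℝ) ℝ) (n : ℕ)
    (t : ℝ × ℝ) : |spinAverage h F n t| ≤ ‖F‖ := by
  have := norm_integral_le_of_norm_le_const (μ := stdGaussianSeq)
    (f := fun g => F (zeroExtend n (spin h n t (truncate n g))))
    (Eventually.of_forall fun g => F.norm_coe_le_norm _)
  rw [probReal_univ, mul_one] at this
  exact this

theorem spinAverage_eq (h : ℕ → ℝ) (F : BoundedContinuousFunction (ℕ → ℝ) ℝ) (n : ℕ)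
    (t : ℝ × ℝ) : spinAverage h F n t =
      ∫ g, F (zeroExtend n (spin h n t g)) ∂stdGaussian (EuclideanSpace ℝ (Fin n)) := by
  rw [← map_truncate_stdGaussianSeq, integral_map (measurable_truncate _).aemeasurable]
  · rfl
  · exact (F.continuous.measurable.comp ((measurable_zeroExtend _).comp ((measurable_spin h _).comp
      (measurable_prodMk_left (x := t))))).aestronglyMeasurable

/-- Dominated convergence along the product filter; the exceptional null set of Gaussian sequences
does not depend on `t`. -/
theorem tendsto_spinAverage {h : ℕ → ℝ} {m z : ℝ × ℝ}
    (hm1 : Tendsto (fieldMean h) atTop (𝓝 m.1)) (hm2 : Tendsto (fieldSD h) atTop (𝓝 m.2))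
    (hm : 0 < m.2) (hz : z ∈ unitDisk) (F : BoundedContinuousFunction (ℕ → ℝ) ℝ) :
    Tendsto (fun p : ℕ × (ℝ × ℝ) => spinAverage h F p.1 p.2) (atTop ×ˢ 𝓝 (gnomonic z))
      (𝓝 (∫ g, F (transportMap m z h g) ∂stdGaussianSeq)) := by
  refine tendsto_integral_filter_of_dominated_convergence (fun _ => ‖F‖)
    (Eventually.of_forall fun p => ?_)
    (Eventually.of_forall fun p => Eventually.of_forall fun g => F.norm_coe_le_norm _)
    (integrable_const _) ?_
  · exact ((measurable_comp_spin_truncate h F p.1).comp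
      (measurable_prodMk_left (x := p.2))).aestronglyMeasurable
  · filter_upwards [ae_tendsto_inner_truncate_div_sqrt onesDir norm_onesDir_le,
      ae_tendsto_inner_truncate_div_sqrt (fieldDir h) (norm_fieldDir_le h),
      ae_tendsto_sum_sq_div] with g ha hb hg
    exact (F.continuous.tendsto _).comp (tendsto_zeroExtend_spin hm1 hm2 hm hz ha hb hg)

/-- Convergence of the Gibbs states for a fixed field with convergent empirical mean and
standard deviation. -/
theorem tendsto_gibbsState {β J : ℝ} (hβ : 0 < β) (hJ : 0 < J) {h : ℕ → ℝ} {m z : ℝ × ℝ}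
    (hm1 : Tendsto (fieldMean h) atTop (𝓝 m.1)) (hm2 : Tendsto (fieldSD h) atTop (𝓝 m.2))
    (hm : 0 < m.2) (hz : maximizers β J m = {z}) :
    Tendsto (fun n : ℕ => gibbsState β J h (n + 1)) atTop (𝓝 (limitState m z h)) := by
  have hzd : z ∈ unitDisk := by
    have : z ∈ maximizers β J m := by simp [hz]
    exact this.1
  rw [ProbabilityMeasure.tendsto_iff_forall_integral_tendsto]
  intro F
  have hlim : ∫ x, F x ∂(limitState m z h : Measure (ℕ → ℝ)) =
      ∫ g, F (transportMap m z h g) ∂stdGaussianSeq :=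
    integral_map (measurable_transportMap m z h).aemeasurable
      F.continuous.measurable.aestronglyMeasurable
  have hε : Tendsto (fun n => β * (|fieldMean h n - m.1| + |fieldSD h n - m.2|)) atTop (𝓝 0) := by
    have := (((hm1.sub_const m.1).abs).add ((hm2.sub_const m.2).abs)).const_mul β
    simpa using this
  have key := tendsto_integral_exp_mul_div (μ := (volume : Measure (ℝ × ℝ)))
    (Φ := fun n t => tiltingFunction β J (fieldMean h n, fieldSD h n) (diskPoint t))
    (continuous_tiltingFunction_diskPoint β J m)
    (tiltingFunction_diskPoint_le_gnomonic hz) (fun U hU => exists_tiltingFunction_gap hβ hJ hz hU)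
    (integrable_exp_tiltingFunction hβ hJ m)
    (fun n => (continuous_tiltingFunction_diskPoint β J (fieldMean h n, fieldSD h n)).measurable)
    hε (fun n t => abs_tiltingFunction_sub_le hβ J m (fieldMean h n, fieldSD h n) t)
    (measurable_spinAverage h F) (abs_spinAverage_le h F) (tendsto_spinAverage hm1 hm2 hm hzd F)
  rw [hlim]
  refine (key.comp (tendsto_add_atTop_nat 1)).congr' ?_
  -- The representation needs dimension `n + 1 ≥ 3` and a nonconstant field, and both hold
  -- eventually.
  filter_upwards [eventually_ge_atTop 2,
    (tendsto_add_atTop_nat 1).eventually (hm2.eventually (lt_mem_nhds hm))] with n hn hs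
  rw [integral_gibbsState β J h (n + 1) (by omega) hs F]
  simp only [Function.comp_apply, spinAverage_eq]

/-! ### Measurability in the field -/

theorem measurable_hamiltonian (J : ℝ) (n : ℕ) :
    Measurable fun p : (ℕ → ℝ) × EuclideanSpace ℝ (Fin n) => hamiltonian J p.1 n p.2 := by
  unfold hamiltonian; fun_prop

/-- The Gibbs density is jointly measurable in field and spin, so its integral over a fixed event is
measurable in the field. -/
theorem measurable_gibbsState (β J : ℝ) (n : ℕ) [NeZero n] :
    Measurable fun h : ℕ → ℝ => gibbsState β J h n := by
  refine Measurable.subtype_mk (Measure.measurable_of_measurable_coe _ fun s hs => ?_)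
  have hH := measurable_hamiltonian J n
  have hE : Measurable fun p : (ℕ → ℝ) × EuclideanSpace ℝ (Fin n) =>
      Real.exp (-β * hamiltonian J p.1 n p.2) := by fun_prop
  have hZ : Measurable fun h : ℕ → ℝ =>
      ∫ φ, Real.exp (-β * hamiltonian J h n φ) ∂uniformSphere n :=
    hE.stronglyMeasurable.integral_prod_right'.measurable
  have hs' : MeasurableSet (zeroExtend n ⁻¹' s) := measurable_zeroExtend n hs
  have key : Measurable fun h : ℕ → ℝ => ∫⁻ φ in zeroExtend n ⁻¹' s,
      ENNReal.ofReal (Real.exp (-β * hamiltonian J h n φ) /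
        ∫ φ, Real.exp (-β * hamiltonian J h n φ) ∂uniformSphere n) ∂uniformSphere n :=
    Measurable.lintegral_prod_right' (f := fun p : (ℕ → ℝ) × EuclideanSpace ℝ (Fin n) =>
      ENNReal.ofReal (Real.exp (-β * hamiltonian J p.1 n p.2) /
        ∫ φ, Real.exp (-β * hamiltonian J p.1 n φ) ∂uniformSphere n))
      (hE.div (hZ.comp measurable_fst)).ennreal_ofReal
  convert key using 2 with h
  rw [Measure.map_apply (measurable_zeroExtend n) hs, gibbsMeasure, tilted_apply' _ _ hs']

theorem measurable_limitState (m z : ℝ × ℝ) :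
    Measurable fun h : ℕ → ℝ => limitState m z h := by
  refine Measurable.subtype_mk (Measure.measurable_of_measurable_coe _ fun s hs => ?_)
  have hT : Measurable fun p : (ℕ → ℝ) × (ℕ → ℝ) => transportMap m z p.1 p.2 := by
    unfold transportMap; fun_prop
  convert measurable_measure_prodMk_left (ν := stdGaussianSeq) (hT hs) using 2 with h
  rw [Measure.map_apply (measurable_transportMap m z h) hs]
  rfl

/-! ### The random field -/

section Field

variable {Ω Ω₀ : Type*} [MeasurableSpace Ω] [MeasurableSpace Ω₀] {P : Measure Ω}
  {P₀ : Measure Ω₀} {h : Ω → ℕ → ℝ} {h₀ : Ω₀ → ℝ}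

/-- The strong law for `u (h i)`; applied to the identity and the square, it yields the empirical
mean and deviation. -/
theorem IsIIDField.ae_tendsto_average_comp (hh : IsIIDField P P₀ h h₀) {u : ℝ → ℝ}
    (hu : Measurable u) (hint : Integrable (fun ω => u (h₀ ω)) P₀) :
    ∀ᵐ ω ∂P, Tendsto (fun n : ℕ => (∑ i ∈ Finset.range n, u (h ω i)) / n) atTop
      (𝓝 (∫ ω, u (h₀ ω) ∂P₀)) := by
  have hid : ∀ i, IdentDistrib (fun ω => u (h ω i)) (fun ω => u (h₀ ω)) P P₀ := fun i =>
    (hh.identDistrib i).comp hu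
  have := strong_law_ae_real (μ := P) (fun i ω => u (h ω i)) ((hid 0).integrable_iff.2 hint)
    (fun i j hij => (hh.indep.indepFun hij).comp hu hu) (fun i => (hid i).trans (hid 0).symm)
  rwa [(hid 0).integral_eq] at this

theorem IsIIDField.ae_tendsto_fieldMean [IsProbabilityMeasure P₀] (hh : IsIIDField P P₀ h h₀) :
    ∀ᵐ ω ∂P, Tendsto (fieldMean (h ω)) atTop (𝓝 (meanSD P₀ h₀).1) := by
  filter_upwards [hh.ae_tendsto_average_comp (u := fun x => x) measurable_id
    (hh.memLp_two.integrable one_le_two)] with ω hω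
  exact hω

theorem IsIIDField.ae_tendsto_fieldSD [IsProbabilityMeasure P₀] (hh : IsIIDField P P₀ h h₀) :
    ∀ᵐ ω ∂P, Tendsto (fieldSD (h ω)) atTop (𝓝 (meanSD P₀ h₀).2) := by
  filter_upwards [hh.ae_tendsto_fieldMean, hh.ae_tendsto_average_comp (u := fun x => x ^ 2)
    (by fun_prop) hh.memLp_two.integrable_sq] with ω h1 h2
  have hv : variance h₀ P₀ = (∫ ω, h₀ ω ^ 2 ∂P₀) - (meanSD P₀ h₀).1 ^ 2 :=
    variance_eq_sub hh.memLp_two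
  have := (h2.sub (h1.pow 2)).sqrt
  rwa [← hv] at this

end Field

/-- Integrating a bounded continuous `F` against the metastate gives the Cesàro mean of `F` along
the Gibbs states, which inherits their limit. -/
theorem tendsto_newmanSteinMetastate {β J : ℝ} {h : ℕ → ℝ} {μ : ProbabilityMeasure (ℕ → ℝ)}
    (hμ : Tendsto (fun n : ℕ => gibbsState β J h (n + 1)) atTop (𝓝 μ)) :
    Tendsto (fun N : ℕ => newmanSteinMetastate β J h (N + 1)) atTop (𝓝 (diracProba μ)) := by
  rw [ProbabilityMeasure.tendsto_iff_forall_integral_tendsto]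
  intro F
  have hF : StronglyMeasurable F := F.continuous.measurable.stronglyMeasurable
  have hlim : ∫ ν, F ν ∂(diracProba μ : Measure (ProbabilityMeasure (ℕ → ℝ))) = F μ :=
    integral_dirac' _ _ hF
  have hN : ∀ N : ℕ, ∫ ν, F ν ∂(newmanSteinMetastate β J h (N + 1) :
      Measure (ProbabilityMeasure (ℕ → ℝ))) =
      ((N + 1 : ℕ) : ℝ)⁻¹ * ∑ k ∈ Finset.range (N + 1), F (gibbsState β J h (k + 1)) := by
    intro N
    change ∫ ν, F ν ∂(((N + 1 : ℕ) : ENNReal)⁻¹ • ∑ k ∈ Finset.range (N + 1),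
      Measure.dirac (gibbsState β J h (k + 1))) = _
    rw [integral_smul_measure, integral_finsetSum_measure fun k _ => ?_]
    · simp only [integral_dirac' _ _ hF, smul_eq_mul, ENNReal.toReal_inv, ENNReal.toReal_natCast]
    · exact F.integrable _
  rw [hlim]
  simp_rw [hN]
  exact (((F.continuous.tendsto μ).comp hμ).cesaro).comp (tendsto_add_atTop_nat 1)

theorem mainTheorem9 {Ω Ω₀ : Type*} [MeasurableSpace Ω] [MeasurableSpace Ω₀]
    (P : Measure Ω) [IsProbabilityMeasure P] (P₀ : Measure Ω₀) [IsProbabilityMeasure P₀]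
    (h : Ω → ℕ → ℝ) (h₀ : Ω₀ → ℝ) (hh : IsIIDField P P₀ h h₀)
    (β J : ℝ) (hβ : 0 < β) (hJ : 0 < J)
    (z : ℝ × ℝ) (hPS : maximizers β J (meanSD P₀ h₀) = {z}) :
    TendstoInDistribution
        (fun (n : ℕ) (ω : Ω) => (h ω, gibbsState β J (h ω) (n + 1))) atTop
        (fun ω : Ω => (h ω, limitState (meanSD P₀ h₀) z (h ω))) (fun _ => P) P ∧
      ∀ᵐ ω ∂P, Tendsto (fun N : ℕ => newmanSteinMetastate β J (h ω) (N + 1)) atTop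
        (𝓝 (diracProba (limitState (meanSD P₀ h₀) z (h ω)))) := by
  have hm : 0 < (meanSD P₀ h₀).2 := Real.sqrt_pos.2 hh.variance_pos
  -- Both conclusions follow from this convergence for almost every field.
  have hae : ∀ᵐ ω ∂P, Tendsto (fun n : ℕ => gibbsState β J (h ω) (n + 1)) atTop
      (𝓝 (limitState (meanSD P₀ h₀) z (h ω))) := by
    filter_upwards [hh.ae_tendsto_fieldMean, hh.ae_tendsto_fieldSD] with ω h1 h2
    exact tendsto_gibbsState hβ hJ h1 h2 hm hPS
  refine ⟨tendstoInDistribution_of_ae_tendsto (fun n => ?_) ?_ ?_, ?_⟩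
  · exact (hh.measurable_field.prodMk
      ((measurable_gibbsState β J (n + 1)).comp hh.measurable_field)).aemeasurable
  · exact (hh.measurable_field.prodMk
      ((measurable_limitState _ z).comp hh.measurable_field)).aemeasurable
  · filter_upwards [hae] with ω hω
    exact tendsto_const_nhds.prodMk_nhds hω
  · filter_upwards [hae] with ω hω
    exact tendsto_newmanSteinMetastate hω
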